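/- Let $d\in\{2,3\}$. There is a constant $c>0$ depending only on $d$ (in particular independent of the size, the angles and the aspect ratio of the simplex) such that the following holds for every nondegenerate closed $d$-simplex $T\subset\mathbb{R}^d$ with vertices $p_1,\dots,p_{d+1}$ labelled according to the following condition. If $d=2$: $\overline{p_2p_3}$ is a longest edge of $T$, and $h_2\le h_1$, where $h_1:=|p_1-p_2|$, $h_2:=|p_1-p_3|$; put $r_1:=\frac{p_2-p_1}{|p_2-p_1|}$, $r_2:=\frac{p_3-p_1}{|p_3-p_1|}$. If $d=3$: let $E$ be the plane through the midpoint of $\overline{p_1p_2}$ perpendicular to $p_1-p_2$. The point $p_4$ lies in the closed half-space bounded by $E$ that contains $p_1$. An edge $L_{\min}$ of $T$ of minimal length is $\overline{p_1p_3}$ if $p_3$ also lies in that closed half-space (type (i)), and is $\overline{p_2p_3}$ if $p_3$ lies in the closed half-space that contains $p_2$ (type (ii)); if $p_3\in E$, either type may be used. Moreover $\overline{p_1p_2}$ is a longest one among the four edges that share exactly one endpoint with $L_{\min}$. Put $h_1:=|p_1-p_2|$, $h_2:=|L_{\min}|$, $h_3:=|p_1-p_4|$, $r_1:=\frac{p_2-p_1}{|p_2-p_1|}$,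 $r_3:=\frac{p_4-p_1}{|p_4-p_1|}$, and $r_2:=\frac{p_3-p_1}{|p_3-p_1|}$ for type (i), $r_2:=\frac{p_3-p_2}{|p_3-p_2|}$ for type (ii). Let $F_i$ be the face of $T$ opposite to $p_i$, $\lambda_i$ the barycentric coordinates of $T$, and $\theta_i:=d\left(\frac1d-\lambda_i\right)$, $i=1,\dots,d+1$. The Crouzeix–Raviart interpolant of $\varphi\in H^1(T)$ is $$I_T^{CR}\varphi:=\sum_{i=1}^{d+1}\left(\frac{1}{|F_i|_{d-1}}\int_{F_i}\varphi\,ds\right)\theta_i,$$ where $\varphi$ on $F_i$ is understood as its trace. Then for all $\varphi\in H^2(T)$ the traces of $\varphi$ on the faces exist in $L^2(F_i)$, $I_T^{CR}\varphi-\varphi\in H^1(T)$, and $$|I_T^{CR}\varphi-\varphi|_{H^1(T)}\le c\sum_{i=1}^d h_i\left\|\frac{\partial}{\partial r_i}\nabla\varphi\right\|_{L^2(T)^d},$$ where $\frac{\partial}{\partial r_i}\nabla\varphi$ is the vector with components $(r_i\cdot\nabla)\frac{\partial\varphi}{\partial x_k}$, $k=1,\dots,d$, and $|v|_{H^1(T)}:=\|\nabla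 v\|_{L^2(T)^d}$. -/

import Mathlib

open MeasureTheory Filter Topology
open scoped ContDiff Gradient ENNReal

noncomputable section

namespace CrouzeixRaviart

/-! ### Sobolev spaces on an open set through weak derivatives -/

/-- `G` is a weak gradient of `f` on the open set `U`: both are locally integrable on `U` and
`∫_U f ∂_v η = - ∫_U (v · G) η` for all test functions `η ∈ C_c^∞(U)` and all directions `v`. -/
structure HasWeakGradient {d : ℕ} (U : Set (EuclideanSpace ℝ (Fin d)))
    (f : EuclideanSpace ℝ (Fin d) → ℝ)
    (G : EuclideanSpace ℝ (Fin d) → EuclideanSpace ℝ (Fin d)) : Prop where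
  locallyIntegrableOn_fun : LocallyIntegrableOn f U
  locallyIntegrableOn_grad : LocallyIntegrableOn G U
  integral_eq : ∀ η : EuclideanSpace ℝ (Fin d) → ℝ,
    ContDiff ℝ ∞ η → HasCompactSupport η → tsupport η ⊆ U →
    ∀ v : EuclideanSpace ℝ (Fin d),
      ∫ x in U, f x * fderiv ℝ η x v = - ∫ x in U, inner ℝ v (G x) * η x

open Classical in
/-- The weak gradient `∇f` of `f` on `U` (unique up to null sets); `0` if there is none. -/
def weakGrad {d : ℕ} (U : Set (EuclideanSpace ℝ (Fin d))) (f : EuclideanSpace ℝ (Fin d) → ℝ) :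
    EuclideanSpace ℝ (Fin d) → EuclideanSpace ℝ (Fin d) :=
  if h : ∃ G, HasWeakGradient U f G then h.choose else 0

/-- `f ∈ H¹(U)`. -/
def MemH1 {d : ℕ} (U : Set (EuclideanSpace ℝ (Fin d))) (f : EuclideanSpace ℝ (Fin d) → ℝ) :
    Prop :=
  MemLp f 2 (volume.restrict U) ∧
    ∃ G, HasWeakGradient U f G ∧ MemLp G 2 (volume.restrict U)

/-- `f ∈ H²(U)`: `f` and all its first weak partial derivatives lie in `H¹(U)`. -/
def MemH2 {d : ℕ} (U : Set (EuclideanSpace ℝ (Fin d))) (f : EuclideanSpace ℝ (Fin d) → ℝ) :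
    Prop :=
  MemH1 U f ∧ ∀ k : Fin d, MemH1 U (fun x => weakGrad U f x k)

/-- The seminorm `|f|_{H¹(U)} = ‖∇f‖_{L²(U)^d}`. -/
def h1Seminorm {d : ℕ} (U : Set (EuclideanSpace ℝ (Fin d)))
    (f : EuclideanSpace ℝ (Fin d) → ℝ) : ℝ :=
  lpNorm (weakGrad U f) 2 (volume.restrict U)

/-- The vector field `∂(∇f)/∂r = ((r · ∇) ∂₁f, …, (r · ∇) ∂_d f)` on `U`. -/
def dirDerivGrad {d : ℕ} (U : Set (EuclideanSpace ℝ (Fin d))) (r : EuclideanSpace ℝ (Fin d))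
    (f : EuclideanSpace ℝ (Fin d) → ℝ) : EuclideanSpace ℝ (Fin d) → EuclideanSpace ℝ (Fin d) :=
  fun x => WithLp.toLp 2 fun k => inner ℝ r (weakGrad U (fun y => weakGrad U f y k) x)

/-! ### Simplices, faces, traces and the Crouzeix–Raviart interpolant

A nondegenerate `d`-simplex in `ℝ^d` is given by its vertices, an affine basis `T` of `ℝ^d`
indexed by `Fin (d + 1)`; its barycentric coordinates are `T.coord i`. -/

/-- The (open) simplex with vertices `T`. -/
def openSimplex {d : ℕ} (T : AffineBasis (Fin (d + 1)) ℝ (EuclideanSpace ℝ (Fin d))) :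
    Set (EuclideanSpace ℝ (Fin d)) :=
  interior (convexHull ℝ (Set.range T))

/-- The closed face of the simplex opposite to its `i`-th vertex. -/
def face {d : ℕ} (T : AffineBasis (Fin (d + 1)) ℝ (EuclideanSpace ℝ (Fin d))) (i : Fin (d + 1)) :
    Set (EuclideanSpace ℝ (Fin d)) :=
  convexHull ℝ (T '' {i}ᶜ)

/-- The surface measure on the `i`-th face: the `(d-1)`-dimensional Hausdorff measure, normalised
so as to agree with Lebesgue measure on `(d-1)`-dimensional Euclidean spaces. -/
def faceMeasure {d : ℕ} (T : AffineBasis (Fin (d + 1)) ℝ (EuclideanSpace ℝ (Fin d)))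
    (i : Fin (d + 1)) : Measure (EuclideanSpace ℝ (Fin d)) :=
  (Measure.euclideanHausdorffMeasure (d - 1)).restrict (face T i)

/-- `g ∈ L²(F_i)` is the trace on the face `F_i` of the function `f ∈ H¹(T)`: it is the
`L²(F_i)`-limit of the restrictions to `F_i` of smooth functions that converge to `f` in
`H¹(T)`. -/
def IsTrace {d : ℕ} (T : AffineBasis (Fin (d + 1)) ℝ (EuclideanSpace ℝ (Fin d)))
    (i : Fin (d + 1)) (f g : EuclideanSpace ℝ (Fin d) → ℝ) : Prop :=
  MemLp g 2 (faceMeasure T i) ∧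
  ∃ u : ℕ → EuclideanSpace ℝ (Fin d) → ℝ,
    (∀ n, ContDiff ℝ ∞ (u n)) ∧
    Tendsto (fun n => eLpNorm (fun x => u n x - f x) 2 (volume.restrict (openSimplex T)))
      atTop (𝓝 0) ∧
    Tendsto (fun n => eLpNorm (fun x => gradient (u n) x - weakGrad (openSimplex T) f x) 2
      (volume.restrict (openSimplex T))) atTop (𝓝 0) ∧
    Tendsto (fun n => eLpNorm (fun x => u n x - g x) 2 (faceMeasure T i)) atTop (𝓝 0)

open Classical in
/-- The trace of `f` on the `i`-th face (unique up to null sets of the face); `0` if there is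
none. -/
def trace {d : ℕ} (T : AffineBasis (Fin (d + 1)) ℝ (EuclideanSpace ℝ (Fin d)))
    (i : Fin (d + 1)) (f : EuclideanSpace ℝ (Fin d) → ℝ) : EuclideanSpace ℝ (Fin d) → ℝ :=
  if h : ∃ g, IsTrace T i f g then h.choose else 0

/-- The nodal basis function `θ_i = d (1/d - λ_i)`. -/
def nodalBasis {d : ℕ} (T : AffineBasis (Fin (d + 1)) ℝ (EuclideanSpace ℝ (Fin d)))
    (i : Fin (d + 1)) (x : EuclideanSpace ℝ (Fin d)) : ℝ :=
  (d : ℝ) * (1 / (d : ℝ) - T.coord i x)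

/-- The Crouzeix–Raviart interpolant `I^{CR} f = ∑_i (|F_i|⁻¹ ∫_{F_i} f ds) θ_i`. -/
def interpolant {d : ℕ} (T : AffineBasis (Fin (d + 1)) ℝ (EuclideanSpace ℝ (Fin d)))
    (f : EuclideanSpace ℝ (Fin d) → ℝ) : EuclideanSpace ℝ (Fin d) → ℝ :=
  fun x => ∑ i : Fin (d + 1), (⨍ y, trace T i f y ∂(faceMeasure T i)) * nodalBasis T i x

/-! ### The edge conditions

The vertices `p₁, …, p_{d+1}` are numbered `p 0, …, p d` here. -/

/-- The condition on the labelling of the vertices of a triangle: `p₂p₃` is the longest edge, and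
`h₂ = |p₁ - p₃| ≤ |p₁ - p₂| = h₁`. -/
structure TriangleCondition (p : Fin 3 → EuclideanSpace ℝ (Fin 2)) : Prop where
  longest : ∀ i j, dist (p i) (p j) ≤ dist (p 1) (p 2)
  le : dist (p 0) (p 2) ≤ dist (p 0) (p 1)

/-- The common part of the conditions on the labelling of the vertices of a tetrahedron, where `a`
is `p₁` (type i) or `p₂` (type ii): `L_min`, with the endpoints `p a` and `p₃`, is a shortest
edge; `p₁p₂` is a longest one of the four edges that share exactly one endpoint with `L_min`; and
`p₄` lies on the side of `p₁` of the plane through the midpoint of `p₁p₂` orthogonal to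
`p₁ - p₂`. -/
structure TetrahedronCondition (p : Fin 4 → EuclideanSpace ℝ (Fin 3)) (a : Fin 4) : Prop where
  shortest : ∀ i j, i ≠ j → dist (p a) (p 2) ≤ dist (p i) (p j)
  longest : ∀ i j, (i = a ∨ i = 2) → (j ≠ a ∧ j ≠ 2) → dist (p i) (p j) ≤ dist (p 0) (p 1)
  side : 0 ≤ inner ℝ (p 3 - midpoint ℝ (p 0) (p 1)) (p 0 - p 1)

/-- `EdgeCondition d p b` says that the labelled vertices `p` of a `d`-simplex, `d ∈ {2, 3}`,
satisfy the edge condition, and that the `i`-th distinguished edge joins the vertex `b i` to the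
vertex `i + 1` (counting vertices from `0` and edges from `0`).
* `d = 2`: the edges are `p₁p₂`, `p₁p₃`.
* `d = 3`, type (i) (`p₃` and `p₄` on the same side): the edges are `p₁p₂`, `p₁p₃`, `p₁p₄`.
* `d = 3`, type (ii) (`p₃` and `p₄` on different sides): the edges are `p₁p₂`, `p₂p₃`, `p₁p₄`. -/
inductive EdgeCondition :
    (d : ℕ) → (Fin (d + 1) → EuclideanSpace ℝ (Fin d)) → (Fin d → Fin (d + 1)) → Prop
  | triangle (p : Fin 3 → EuclideanSpace ℝ (Fin 2)) (h : TriangleCondition p) :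
      EdgeCondition 2 p ![0, 0]
  | tetrahedronTypeI (p : Fin 4 → EuclideanSpace ℝ (Fin 3)) (h : TetrahedronCondition p 0)
      (side : 0 ≤ inner ℝ (p 2 - midpoint ℝ (p 0) (p 1)) (p 0 - p 1)) :
      EdgeCondition 3 p ![0, 0, 0]
  | tetrahedronTypeII (p : Fin 4 → EuclideanSpace ℝ (Fin 3)) (h : TetrahedronCondition p 1)
      (side : inner ℝ (p 2 - midpoint ℝ (p 0) (p 1)) (p 0 - p 1) ≤ 0) :
      EdgeCondition 3 p ![0, 1, 0]

/-- The length `h_i` of the `i`-th distinguished edge. -/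
def edgeLength {d : ℕ} (p : Fin (d + 1) → EuclideanSpace ℝ (Fin d)) (b : Fin d → Fin (d + 1))
    (i : Fin d) : ℝ :=
  ‖p i.succ - p (b i)‖

/-- The unit vector `r_i` along the `i`-th distinguished edge. -/
def edgeDir {d : ℕ} (p : Fin (d + 1) → EuclideanSpace ℝ (Fin d)) (b : Fin d → Fin (d + 1))
    (i : Fin d) : EuclideanSpace ℝ (Fin d) :=
  (‖p i.succ - p (b i)‖)⁻¹ • (p i.succ - p (b i))

end CrouzeixRaviart

end

/-! The gradient of the Crouzeix–Raviart interpolant is constant and equals the mean of `∇φ` over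
the simplex. Each component of the error gradient is therefore `g - ⨍ g` with `g = ∂ₖφ`, up to sign,
and the estimate becomes a Poincaré inequality for `g` that must not see the shape of the simplex.

The mean identity (`inner_gradient_interpolant`) rests on a divergence theorem for the field `u(x)(x
- pᵢ)`: the integral of `d u + ∇u·(x - pᵢ)` over `T` is a constant times the integral of `u` over
`Fᵢ` (`exists_cone_formula`). This expresses face means by volume integrals. In the combination `-d
∑ᵢ mᵢ ∇λᵢ` of the means `mᵢ`, the relations `∑ ∇λᵢ = 0` and `∑ (∇λᵢ·v) pᵢ = v` leave only the mean
gradient. Applied to `u²`, the same formula gives a trace inequality, hence traces on `H¹`.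

For the Poincaré inequality (`MemH1.eLpNorm_sub_average_le`), `u(x) - u(y)` is integrated along the
segment from `y` to `x`. The distinguished edges form a spanning tree of the vertices, so `x - y` is
a combination of the vectors `hᵢ rᵢ` with coefficients at most 2 in absolute value
(`EdgeCondition.exists_coeff`). The integrand is thus at most `2 ∑ hᵢ |∂u/∂rᵢ|`, and averaging over
all pairs costs only a factor depending on `d`.

Both identities are proved for smooth functions and extended to `H¹` by density. On a convex set the
approximation averages `f` over contractions towards interior points, so no extension beyond the
boundary is needed (`MemH1.exists_smooth_approx`). -/

namespace CrouzeixRaviart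

/-! ### Basic properties of weak gradients -/

section WeakGradient

variable {d : ℕ} {U : Set (EuclideanSpace ℝ (Fin d))}
  {f f' : EuclideanSpace ℝ (Fin d) → ℝ}
  {G G' : EuclideanSpace ℝ (Fin d) → EuclideanSpace ℝ (Fin d)}

theorem integrable_smul_of_tsupport_subset {F : Type*} [NormedAddCommGroup F] [NormedSpace ℝ F]
    {g : EuclideanSpace ℝ (Fin d) → F} (hg : LocallyIntegrableOn g U)
    {η : EuclideanSpace ℝ (Fin d) → ℝ} (hη : Continuous η) (hc : HasCompactSupport η)
    (hs : tsupport η ⊆ U) : Integrable (fun x => η x • g x) := by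
  rw [← integrableOn_iff_integrable_of_support_subset (s := tsupport η)]
  · exact (hg.integrableOn_compact_subset hs hc.isCompact).continuousOn_smul hη.continuousOn
      hc.isCompact
  · intro x hx
    apply subset_tsupport
    intro h
    simp [h] at hx

theorem setIntegral_eq_integral_of_tsupport_subset {F : Type*} [NormedAddCommGroup F]
    [NormedSpace ℝ F] {g : EuclideanSpace ℝ (Fin d) → F}
    {η : EuclideanSpace ℝ (Fin d) → ℝ}
    (hs : tsupport η ⊆ U) (h0 : ∀ x, η x = 0 → g x = 0) : ∫ x in U, g x = ∫ x, g x :=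
  setIntegral_eq_integral_of_forall_compl_eq_zero fun x hx =>
    h0 x (image_eq_zero_of_notMem_tsupport fun h => hx (hs h))

/-- The fundamental lemma of the calculus of variations, tested direction by direction. Since
`weakGrad` is defined by choice, this is what allows it to be replaced by any explicit weak
gradient. -/
theorem HasWeakGradient.ae_eq (hU : IsOpen U) (h : HasWeakGradient U f G)
    (h' : HasWeakGradient U f G') : G =ᵐ[volume.restrict U] G' := by
  have hGG := h.locallyIntegrableOn_grad.sub h'.locallyIntegrableOn_grad
  have key : ∀ᵐ x ∂(volume : Measure (EuclideanSpace ℝ (Fin d))), x ∈ U → (G - G') x = 0 := by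
    refine hU.ae_eq_zero_of_integral_contDiff_smul_eq_zero hGG fun η hη hc hs => ?_
    have hi := integrable_smul_of_tsupport_subset hGG hη.continuous hc hs
    have hi1 := integrable_smul_of_tsupport_subset h.locallyIntegrableOn_grad hη.continuous hc hs
    have hi2 := integrable_smul_of_tsupport_subset h'.locallyIntegrableOn_grad hη.continuous hc hs
    refine ext_inner_left ℝ fun v => ?_
    rw [inner_zero_right, ← integral_inner hi]
    have e := h.integral_eq η hη hc hs v
    have e' := h'.integral_eq η hη hc hs v
    rw [e, neg_inj] at e'
    rw [setIntegral_eq_integral_of_tsupport_subset hs (by intro x hx; simp [hx]),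
      setIntegral_eq_integral_of_tsupport_subset hs (by intro x hx; simp [hx])] at e'
    have : ∀ x, inner ℝ v (η x • (G - G') x)
        = inner ℝ v (G x) * η x - inner ℝ v (G' x) * η x := by
      intro x
      simp only [Pi.sub_apply, inner_smul_right, inner_sub_right]
      ring
    simp_rw [this]
    rw [integral_sub, e', sub_self]
    · simpa [inner_smul_right, mul_comm] using hi1.const_inner (𝕜 := ℝ) v
    · simpa [inner_smul_right, mul_comm] using hi2.const_inner (𝕜 := ℝ) v
  rw [EventuallyEq, ae_restrict_iff' hU.measurableSet]
  filter_upwards [key] with x hx hxU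
  exact sub_eq_zero.1 (hx hxU)

theorem HasWeakGradient.hasWeakGradient_weakGrad (h : HasWeakGradient U f G) :
    HasWeakGradient U f (weakGrad U f) := by
  have h' : ∃ G, HasWeakGradient U f G := ⟨G, h⟩
  rw [weakGrad, dif_pos h']
  exact h'.choose_spec

theorem HasWeakGradient.weakGrad_ae_eq (hU : IsOpen U) (h : HasWeakGradient U f G) :
    weakGrad U f =ᵐ[volume.restrict U] G :=
  h.hasWeakGradient_weakGrad.ae_eq hU h

theorem MemH1.hasWeakGradient (h : MemH1 U f) : HasWeakGradient U f (weakGrad U f) :=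
  let ⟨_, hG, _⟩ := h.2
  hG.hasWeakGradient_weakGrad

theorem MemH1.memLp_weakGrad (hU : IsOpen U) (h : MemH1 U f) :
    MemLp (weakGrad U f) 2 (volume.restrict U) :=
  let ⟨_, hG, hG2⟩ := h.2
  hG2.ae_eq (hG.weakGrad_ae_eq hU).symm

theorem HasWeakGradient.sub (h : HasWeakGradient U f G) (h' : HasWeakGradient U f' G') :
    HasWeakGradient U (fun x => f x - f' x) (fun x => G x - G' x) where
  locallyIntegrableOn_fun := h.1.sub h'.1
  locallyIntegrableOn_grad := h.2.sub h'.2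
  integral_eq η hη hc hs v := by
    have hcd : HasCompactSupport (fun x => fderiv ℝ η x v) := hc.fderiv_apply (𝕜 := ℝ) v
    have hsd : tsupport (fun x => fderiv ℝ η x v) ⊆ U :=
      (tsupport_fderiv_apply_subset ℝ v).trans hs
    have hd : Continuous (fun x => fderiv ℝ η x v) :=
      (hη.continuous_fderiv (by simp)).clm_apply continuous_const
    have i1 := (integrable_smul_of_tsupport_subset h.1 hd hcd hsd).integrableOn (s := U)
    have i2 := (integrable_smul_of_tsupport_subset h'.1 hd hcd hsd).integrableOn (s := U)
    have i3 := ((integrable_smul_of_tsupport_subset h.2 hη.continuous hc hs).const_inner (𝕜 := ℝ)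
      v).integrableOn (s := U)
    have i4 := ((integrable_smul_of_tsupport_subset h'.2 hη.continuous hc hs).const_inner (𝕜 := ℝ)
      v).integrableOn (s := U)
    simp only [smul_eq_mul, inner_smul_right, mul_comm (fderiv ℝ η _ v), mul_comm (η _)]
      at i1 i2 i3 i4
    simp only [sub_mul, inner_sub_right]
    rw [integral_sub i1 i2, integral_sub i3 i4, h.integral_eq η hη hc hs v,
      h'.integral_eq η hη hc hs v]
    ring

theorem hasWeakGradient_of_contDiff (hf : ContDiff ℝ 1 f) :
    HasWeakGradient U f (gradient f) where
  locallyIntegrableOn_fun := hf.continuous.locallyIntegrable.locallyIntegrableOn U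
  locallyIntegrableOn_grad := by
    have : Continuous (gradient f) :=
      (LinearIsometryEquiv.continuous _).comp (hf.continuous_fderiv (by simp))
    exact this.locallyIntegrable.locallyIntegrableOn U
  integral_eq η hη hc hs v := by
    have e : ∀ x, inner ℝ v (gradient f x) = fderiv ℝ f x v := by
      intro x
      rw [real_inner_comm, gradient, InnerProductSpace.toDual_symm_apply]
    simp_rw [e]
    rw [setIntegral_eq_integral_of_tsupport_subset (η := fun x => fderiv ℝ η x v)
        ((tsupport_fderiv_apply_subset ℝ v).trans hs) (by intro x hx; simp [hx]),
      setIntegral_eq_integral_of_tsupport_subset hs (by intro x hx; simp [hx])]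
    have hd : Continuous (fun x => fderiv ℝ η x v) :=
      (hη.continuous_fderiv (by simp)).clm_apply continuous_const
    have hfd : Continuous (fun x => fderiv ℝ f x v) :=
      (hf.continuous_fderiv (by simp)).clm_apply continuous_const
    apply integral_mul_fderiv_eq_neg_fderiv_mul_of_integrable
    · exact (hfd.mul hη.continuous).integrable_of_hasCompactSupport hc.mul_left
    · exact (hf.continuous.mul hd).integrable_of_hasCompactSupport
        (hc.fderiv_apply (𝕜 := ℝ) v).mul_left
    · exact (hf.continuous.mul hη.continuous).integrable_of_hasCompactSupport hc.mul_left
    · intro x _; exact hf.differentiable (by simp) x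
    · intro x _; exact hη.differentiable (by simp) x

end WeakGradient


/-! ### Jensen's inequality and scaling -/

theorem eLpNorm_two_sq {α F : Type*} [MeasurableSpace α] [NormedAddCommGroup F] (f : α → F)
    (μ : Measure α) : eLpNorm f 2 μ ^ 2 = ∫⁻ x, ‖f x‖ₑ ^ 2 ∂μ := by
  have := eLpNorm_nnreal_pow_eq_lintegral (μ := μ) (f := f) (p := 2) (by simp)
  simpa using this

theorem eLpNorm_two_le_of_lintegral_le {α F : Type*} [MeasurableSpace α] [NormedAddCommGroup F]
    {f : α → F} {μ : Measure α} {c : ℝ≥0∞} (h : ∫⁻ x, ‖f x‖ₑ ^ 2 ∂μ ≤ c ^ 2) :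
    eLpNorm f 2 μ ≤ c := by
  rwa [← eLpNorm_two_sq, ENNReal.pow_le_pow_left_iff (by simp)] at h

/-- Hölder's inequality against the constant 1, whose norm is 1 under a probability measure. -/
theorem sq_lintegral_le {α : Type*} [MeasurableSpace α] {P : Measure α} [IsProbabilityMeasure P]
    {f : α → ℝ≥0∞} (hf : AEMeasurable f P) : (∫⁻ x, f x ∂P) ^ 2 ≤ ∫⁻ x, f x ^ 2 ∂P := by
  have h := ENNReal.lintegral_mul_le_Lp_mul_Lq P Real.HolderConjugate.two_two hf
    (aemeasurable_const (b := (1 : ℝ≥0∞)))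
  simp only [Pi.mul_apply, mul_one, ENNReal.one_rpow, lintegral_const, measure_univ] at h
  calc (∫⁻ x, f x ∂P) ^ 2 ≤ ((∫⁻ x, f x ^ (2 : ℝ) ∂P) ^ (1 / 2 : ℝ)) ^ 2 := by gcongr
    _ = ∫⁻ x, f x ^ 2 ∂P := by
      rw [← ENNReal.rpow_natCast, ← ENNReal.rpow_mul]
      simp

theorem lintegral_comp_smul {d : ℕ} (F : EuclideanSpace ℝ (Fin d) → ℝ≥0∞) {s : ℝ} (hs : 0 < s)
    (y : EuclideanSpace ℝ (Fin d)) :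
    ∫⁻ x, F (y + s • x) = ENNReal.ofReal (s ^ d)⁻¹ * ∫⁻ x, F x := by
  have h1 : MeasurableEmbedding (fun x : EuclideanSpace ℝ (Fin d) => s • x) :=
    measurableEmbedding_const_smul₀ hs.ne'
  rw [← h1.lintegral_map (fun x => F (y + x)), Measure.map_addHaar_smul _ hs.ne',
    lintegral_smul_measure, lintegral_add_left_eq_self, finrank_euclideanSpace_fin,
    abs_of_nonneg (by positivity), smul_eq_mul]

theorem ofReal_inv_pow_le {d : ℕ} {s : ℝ} (hs : 1 / 2 ≤ s) :
    ENNReal.ofReal (s ^ d)⁻¹ ≤ 2 ^ d := by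
  calc ENNReal.ofReal (s ^ d)⁻¹ ≤ ENNReal.ofReal (2 ^ d) := by
        apply ENNReal.ofReal_le_ofReal
        rw [← inv_pow]
        have : 0 < s := by linarith
        refine pow_le_pow_left₀ (by positivity) ?_ d
        rw [inv_le_comm₀ this (by norm_num)]
        linarith
    _ = 2 ^ d := by rw [ENNReal.ofReal_pow (by norm_num)]; simp

/-- By convexity the contraction towards `z` maps `U` into itself, so after the change of variables
only part of `U` is integrated over. The function `F` need not be measurable, since dilations are
measurable embeddings. -/
theorem setLIntegral_comp_convexCombination_le {d : ℕ} {U : Set (EuclideanSpace ℝ (Fin d))}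
    (hU : IsOpen U) (hc : Convex ℝ U) (F : EuclideanSpace ℝ (Fin d) → ℝ≥0∞) {s : ℝ} (hs : 0 < s)
    (hs1 : s ≤ 1) {z : EuclideanSpace ℝ (Fin d)} (hz : z ∈ U) :
    ∫⁻ x in U, F ((1 - s) • z + s • x) ≤ ENNReal.ofReal (s ^ d)⁻¹ * ∫⁻ x in U, F x := by
  rw [← lintegral_indicator hU.measurableSet, ← lintegral_indicator hU.measurableSet,
    ← lintegral_comp_smul _ hs ((1 - s) • z)]
  refine lintegral_mono fun x => ?_
  by_cases hx : x ∈ U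
  · have : (1 - s) • z + s • x ∈ U := hc hz hx (by linarith) hs.le (by ring)
    simp [hx, this]
  · simp [hx]

/-! ### Smooth approximation in `H¹` of a convex open set -/

section Mollify

variable {d : ℕ} {F : Type*} [NormedAddCommGroup F] [NormedSpace ℝ F]
  {U : Set (EuclideanSpace ℝ (Fin d))} {ρ : EuclideanSpace ℝ (Fin d) → ℝ}
  {g : EuclideanSpace ℝ (Fin d) → F} {ε : ℝ}

/-- The average of `g` over contractions of `U`, weighted by `ρ`. -/
noncomputable def mollify (U : Set (EuclideanSpace ℝ (Fin d))) (ρ : EuclideanSpace ℝ (Fin d) → ℝ)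
    (ε : ℝ) (g : EuclideanSpace ℝ (Fin d) → F) (x : EuclideanSpace ℝ (Fin d)) : F :=
  ∫ z, ρ z • U.indicator g ((1 - ε) • x + ε • z)

/-- The substitution `w = y + ε z` moves the dependence on `y` from the rough function `h` to the
smooth weight `ρ`. -/
theorem integral_smul_comp_eq (h : EuclideanSpace ℝ (Fin d) → F) (hε : 0 < ε)
    (y : EuclideanSpace ℝ (Fin d)) :
    ∫ z, ρ z • h (y + ε • z) = ∫ w, ((ε ^ d)⁻¹ * ρ (ε⁻¹ • (w - y))) • h w := by
  have h1 := Measure.integral_comp_smul volume (fun w => ρ (ε⁻¹ • w) • h (y + w)) ε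
  simp only [inv_smul_smul₀ hε.ne', finrank_euclideanSpace_fin] at h1
  rw [h1, abs_of_nonneg (by positivity), ← integral_smul,
    ← integral_add_left_eq_self (fun w => ((ε ^ d)⁻¹ * ρ (ε⁻¹ • (w - y))) • h w) y]
  simp [mul_smul]

theorem mollify_eq_integral (hε : 0 < ε) (x : EuclideanSpace ℝ (Fin d)) :
    mollify U ρ ε g x =
      ∫ w, ((ε ^ d)⁻¹ * ρ (ε⁻¹ • (w - (1 - ε) • x))) • U.indicator g w :=
  integral_smul_comp_eq _ hε _

theorem mollify_congr_ae (hU : IsOpen U) (hε : 0 < ε) {g' : EuclideanSpace ℝ (Fin d) → F}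
    (h : g =ᵐ[volume.restrict U] g') : mollify U ρ ε g = mollify U ρ ε g' := by
  ext x
  rw [mollify_eq_integral hε, mollify_eq_integral hε]
  refine integral_congr_ae ?_
  have := (ae_eq_restrict_iff_indicator_ae_eq hU.measurableSet).1 h
  filter_upwards [this] with w hw
  rw [hw]

end Mollify


/-- A smooth probability density with compact support in `U`. -/
structure IsMollifier {d : ℕ} (U : Set (EuclideanSpace ℝ (Fin d)))
    (ρ : EuclideanSpace ℝ (Fin d) → ℝ) : Prop where
  contDiff : ContDiff ℝ ∞ ρ
  hasCompactSupport : HasCompactSupport ρ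
  tsupport_subset : tsupport ρ ⊆ U
  nonneg : ∀ x, 0 ≤ ρ x
  integral_eq_one : ∫ x, ρ x = 1

theorem exists_isMollifier {d : ℕ} {U : Set (EuclideanSpace ℝ (Fin d))} (hU : IsOpen U)
    (hne : U.Nonempty) : ∃ ρ, IsMollifier U ρ := by
  obtain ⟨z, hz⟩ := hne
  obtain ⟨r, hr, hrU⟩ := Metric.nhds_basis_closedBall.mem_iff.1 (hU.mem_nhds hz)
  let b : ContDiffBump z := ⟨r / 2, r, by linarith, by linarith⟩
  exact ⟨b.normed volume, b.contDiff_normed, b.hasCompactSupport_normed,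
    by rwa [b.tsupport_normed_eq], fun x => b.nonneg_normed x, b.integral_normed⟩

/-! ### Smoothness and gradient of the averaged function. -/

section Smooth

variable {d : ℕ} {U : Set (EuclideanSpace ℝ (Fin d))} {ρ : EuclideanSpace ℝ (Fin d) → ℝ}
  {f : EuclideanSpace ℝ (Fin d) → ℝ}
  {G : EuclideanSpace ℝ (Fin d) → EuclideanSpace ℝ (Fin d)} {ε : ℝ}

/-- The convolution kernel of `mollify`. -/
noncomputable def mollifyKernel (ρ : EuclideanSpace ℝ (Fin d) → ℝ) (ε : ℝ)
    (x : EuclideanSpace ℝ (Fin d)) : ℝ :=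
  (ε ^ d)⁻¹ * ρ (ε⁻¹ • (-x))

theorem IsMollifier.contDiff_mollifyKernel (hρ : IsMollifier U ρ) (ε : ℝ) :
    ContDiff ℝ ∞ (mollifyKernel ρ ε) :=
  contDiff_const.mul (hρ.contDiff.comp (contDiff_id.neg.const_smul ε⁻¹))

theorem IsMollifier.hasCompactSupport_mollifyKernel (hρ : IsMollifier U ρ) (hε : 0 < ε) :
    HasCompactSupport (mollifyKernel ρ ε) := by
  have := hρ.hasCompactSupport.comp_homeomorph
    ((Homeomorph.neg (EuclideanSpace ℝ (Fin d))).trans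
      (Homeomorph.smulOfNeZero ε⁻¹ (inv_ne_zero hε.ne')))
  exact this.mul_left (f := fun _ => (ε ^ d)⁻¹)

theorem mollify_eq_convolution (hε : 0 < ε) : mollify U ρ ε f = fun x =>
    (convolution (U.indicator f) (mollifyKernel ρ ε) (ContinuousLinearMap.mul ℝ ℝ) volume)
      ((1 - ε) • x) := by
  ext x
  rw [mollify_eq_integral hε, convolution_def]
  refine integral_congr_ae (Eventually.of_forall fun w => ?_)
  simp [mollifyKernel, mul_comm]

theorem IsMollifier.contDiff_mollify (hρ : IsMollifier U ρ) (hε : 0 < ε)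
    (hf : Integrable (U.indicator f)) : ContDiff ℝ ∞ (mollify U ρ ε f) := by
  rw [mollify_eq_convolution hε]
  have h : ContDiff ℝ ∞ (convolution (U.indicator f) (mollifyKernel ρ ε)
      (ContinuousLinearMap.mul ℝ ℝ) volume) :=
    (hρ.hasCompactSupport_mollifyKernel hε).contDiff_convolution_right _
      hf.locallyIntegrable (hρ.contDiff_mollifyKernel ε)
  exact h.comp (contDiff_id.const_smul (1 - ε))

/-- The support lies in `(1 - ε) x + ε supp ρ`, hence in `U` by convexity. The kernel is therefore
an admissible test function for every `x ∈ U`, however close to the boundary. -/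
theorem IsMollifier.tsupport_mollifyKernel_subset (hρ : IsMollifier U ρ) (hc : Convex ℝ U)
    (hε : 0 < ε) (hε1 : ε ≤ 1) {x : EuclideanSpace ℝ (Fin d)} (hx : x ∈ U) :
    tsupport (fun w => mollifyKernel ρ ε ((1 - ε) • x - w)) ⊆ U := by
  have h1 : tsupport (fun w => mollifyKernel ρ ε ((1 - ε) • x - w)) ⊆
      (fun w => ε⁻¹ • (w - (1 - ε) • x)) ⁻¹' tsupport ρ := by
    refine closure_minimal ?_ (isClosed_closure.preimage (by fun_prop))
    intro w hw
    apply subset_closure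
    simp only [mollifyKernel, Function.mem_support, neg_sub] at hw
    exact right_ne_zero_of_mul hw
  intro w hw
  have h2 := hρ.tsupport_subset (h1 hw)
  have := hc hx h2 (sub_nonneg.2 hε1) hε.le (by ring)
  simpa [smul_inv_smul₀ hε.ne'] using this

/-- The derivative falls on the convolution kernel, which is a test function supported in `U`, and
the definition of the weak gradient transfers it to `f`. The factor `1 - ε` is the chain rule for
evaluation at `(1 - ε) x`. -/
theorem IsMollifier.gradient_mollify (hρ : IsMollifier U ρ) (hU : IsOpen U) (hc : Convex ℝ U)
    (hε : 0 < ε) (hε1 : ε ≤ 1)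
    (hf : Integrable (U.indicator f)) (hG : HasWeakGradient U f G)
    {x : EuclideanSpace ℝ (Fin d)} (hx : x ∈ U) :
    gradient (mollify U ρ ε f) x = (1 - ε) • mollify U ρ ε G x := by
  have hk := hρ.contDiff_mollifyKernel ε
  have hkc := hρ.hasCompactSupport_mollifyKernel hε
  set k := mollifyKernel ρ ε with hkdef
  set y := (1 - ε) • x with hy
  have hd : HasFDerivAt
      (convolution (U.indicator f) k (ContinuousLinearMap.mul ℝ ℝ) volume)
      (convolution (U.indicator f) (fderiv ℝ k)
        ((ContinuousLinearMap.mul ℝ ℝ).precompR (EuclideanSpace ℝ (Fin d))) volume y) y :=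
    hkc.hasFDerivAt_convolution_right (ContinuousLinearMap.mul ℝ ℝ) hf.locallyIntegrable
      (hk.of_le (by simp)) y
  have hd' := HasFDerivAt.comp x hd ((hasFDerivAt_id (𝕜 := ℝ) x).const_smul (1 - ε))
  replace hd' := hd'.congr_of_eventuallyEq (f₁ := mollify U ρ ε f)
    (Eventually.of_forall fun z => congrFun (mollify_eq_convolution hε) z)
  set η : EuclideanSpace ℝ (Fin d) → ℝ := fun w => k (y - w) with hη
  have hηs : ContDiff ℝ ∞ η := hk.comp (contDiff_const.sub contDiff_id)
  have hηc : HasCompactSupport η := hkc.comp_homeomorph (Homeomorph.subLeft y)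
  have hηU : tsupport η ⊆ U := hρ.tsupport_mollifyKernel_subset hc hε hε1 hx
  -- The sign of the reflection `w ↦ y - w` cancels the one in the integration by parts.
  have hηd : ∀ w v, fderiv ℝ η w v = - fderiv ℝ k (y - w) v := by
    intro w v
    have h : HasFDerivAt η _ w := (hk.differentiable (by simp) (y - w)).hasFDerivAt.comp w
      ((hasFDerivAt_id (𝕜 := ℝ) w).const_sub y)
    rw [h.fderiv]
    simp
  have hkd : Continuous (fun w => fderiv ℝ k (y - w)) :=
    (hk.continuous_fderiv (by simp)).comp (by fun_prop)
  refine ext_inner_left ℝ fun v => ?_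
  have e1 : inner ℝ v (gradient (mollify U ρ ε f) x) = fderiv ℝ (mollify U ρ ε f) x v := by
    rw [real_inner_comm, gradient, InnerProductSpace.toDual_symm_apply]
  have hGi : Integrable (fun w => η w • U.indicator G w) := by
    have := (integrable_smul_of_tsupport_subset hG.2 hηs.continuous hηc hηU).indicator
      hU.measurableSet
    refine this.congr (Eventually.of_forall fun w => ?_)
    by_cases hw : w ∈ U <;> simp [hw]
  have e2 : mollify U ρ ε G x = ∫ w, η w • U.indicator G w := by
    rw [mollify_eq_integral hε]
    simp [hη, hkdef, mollifyKernel, hy]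
  rw [e1, hd'.fderiv, inner_smul_right, e2, ← integral_inner hGi]
  have hint : ConvolutionExistsAt (U.indicator f) (fderiv ℝ k) y
      ((ContinuousLinearMap.mul ℝ ℝ).precompR (EuclideanSpace ℝ (Fin d))) volume :=
    (hkc.fderiv (𝕜 := ℝ)).convolutionExists_right _ hf.locallyIntegrable
      (hk.continuous_fderiv (by simp)) y
  have e3 : (convolution (U.indicator f) (fderiv ℝ k)
      ((ContinuousLinearMap.mul ℝ ℝ).precompR (EuclideanSpace ℝ (Fin d))) volume y) v
      = ∫ w, U.indicator f w * fderiv ℝ k (y - w) v := by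
    rw [convolution_def, ContinuousLinearMap.integral_apply hint]
    simp [ContinuousLinearMap.precompR_apply]
  have e4 : ∫ w, U.indicator f w * fderiv ℝ k (y - w) v
      = - ∫ w in U, f w * fderiv ℝ η w v := by
    rw [← integral_indicator hU.measurableSet, ← integral_neg]
    refine integral_congr_ae (Eventually.of_forall fun w => ?_)
    by_cases hw : w ∈ U <;> simp [hw, hηd]
  have e5 : ∫ w in U, inner ℝ v (G w) * η w = ∫ w, inner ℝ v (η w • U.indicator G w) := by
    rw [← integral_indicator hU.measurableSet]
    refine integral_congr_ae (Eventually.of_forall fun w => ?_)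
    by_cases hw : w ∈ U <;> simp [hw, inner_smul_right, mul_comm]
  rw [← e5, ← neg_neg (∫ w in U, inner ℝ v (G w) * η w), ← hG.integral_eq η hηs hηc hηU v, ← e4,
    ← e3]
  simp [hy]

end Smooth


/-! ### Convergence in `L²` of the averages. -/

section Convergence

variable {d : ℕ} {F : Type*} [NormedAddCommGroup F] [NormedSpace ℝ F]
  {U : Set (EuclideanSpace ℝ (Fin d))} {ρ : EuclideanSpace ℝ (Fin d) → ℝ}
  {g : EuclideanSpace ℝ (Fin d) → F}

omit [NormedSpace ℝ F] in
theorem eLpNorm_comp_convexCombination_le (hU : IsOpen U) (hc : Convex ℝ U)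
    (g : EuclideanSpace ℝ (Fin d) → F) {ε : ℝ} (hε : 0 ≤ ε) (hε2 : ε ≤ 1 / 2)
    {z : EuclideanSpace ℝ (Fin d)} (hz : z ∈ U) :
    eLpNorm (fun x => g ((1 - ε) • x + ε • z)) 2 (volume.restrict U) ≤
      2 ^ d * eLpNorm g 2 (volume.restrict U) := by
  refine eLpNorm_two_le_of_lintegral_le ?_
  rw [mul_pow, eLpNorm_two_sq]
  have h := setLIntegral_comp_convexCombination_le hU hc (fun x => ‖g x‖ₑ ^ 2)
    (s := 1 - ε) (by linarith) (by linarith) hz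
  simp only [sub_sub_cancel] at h
  calc ∫⁻ x in U, ‖g ((1 - ε) • x + ε • z)‖ₑ ^ 2
      = ∫⁻ x in U, ‖g (ε • z + (1 - ε) • x)‖ₑ ^ 2 := by simp_rw [add_comm]
    _ ≤ _ := h
    _ ≤ _ := by
      gcongr
      -- The squared norm grows by at most `2 ^ d`, which is bounded generously by `(2 ^ d) ^ 2` to
      -- avoid a square root.
      exact (ofReal_inv_pow_le (by linarith)).trans
        (le_self_pow₀ (one_le_pow₀ (by norm_num)) (by norm_num))

/-- Contractions of a convex set towards its points are `L²`-close to the identity, uniformly in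
the centre. -/
theorem eventually_eLpNorm_comp_convexCombination_sub_le (hU : IsOpen U) (hc : Convex ℝ U)
    (hb : Bornology.IsBounded U) (hg : MemLp g 2 (volume.restrict U)) (hgm : StronglyMeasurable g)
    {δ : ℝ≥0∞} (hδ : δ ≠ 0) :
    ∀ᶠ ε : ℝ in 𝓝[>] 0, ∀ z ∈ U,
      eLpNorm (fun x => g ((1 - ε) • x + ε • z) - g x) 2 (volume.restrict U) ≤ δ := by
  have hUfin : volume U ≠ ⊤ := hb.measure_lt_top.ne
  -- A continuous compactly supported `h` approximates `g` up to `δ₁`. Composition with a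
  -- contraction multiplies this error by at most `2 ^ d`; the uniform continuity of `h` accounts
  -- for the other `δ / 2`.
  obtain ⟨δ₁, hδ₁, hδ₁'⟩ : ∃ δ₁ : ℝ≥0∞, δ₁ ≠ 0 ∧ 2 ^ d * δ₁ + δ₁ ≤ δ / 2 := by
    refine ⟨δ / 2 / (2 ^ d + 1), ?_, ?_⟩
    · exact (ENNReal.div_pos (ENNReal.div_pos hδ (by simp)).ne' (by simp)).ne'
    · rw [← add_one_mul, ENNReal.mul_div_cancel (by simp) (by simp)]
  obtain ⟨h, hhc, hgh, hcont, hhL⟩ := hg.exists_hasCompactSupport_eLpNorm_sub_le (by simp) hδ₁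
  obtain ⟨δ₂, hδ₂, hδ₂'⟩ : ∃ δ₂ : ℝ, 0 < δ₂ ∧
      (volume.restrict U Set.univ) ^ (1 / (2 : ℝ)) * ENNReal.ofReal δ₂ ≤ δ / 2 := by
    have hV : (volume.restrict U Set.univ) ^ (1 / (2 : ℝ)) ≠ ⊤ := by simp [hUfin]
    have : Tendsto (fun t : ℝ => (volume.restrict U Set.univ) ^ (1 / (2 : ℝ)) * ENNReal.ofReal t)
        (𝓝[>] 0) (𝓝 ((volume.restrict U Set.univ) ^ (1 / (2 : ℝ)) * ENNReal.ofReal 0)) :=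
      ENNReal.Tendsto.const_mul
        ((ENNReal.continuous_ofReal.tendsto 0).mono_left nhdsWithin_le_nhds) (Or.inr hV)
    rw [ENNReal.ofReal_zero, mul_zero] at this
    obtain ⟨t, ht, ht'⟩ := ((this.eventually_le_const
      (ENNReal.div_pos hδ (ENNReal.ofNat_ne_top (n := 2)))).and self_mem_nhdsWithin).exists
    exact ⟨t, ht', ht⟩
  obtain ⟨r, hr, hr'⟩ := Metric.uniformContinuous_iff.1
    (hhc.uniformContinuous_of_continuous hcont) δ₂ hδ₂
  obtain ⟨R, hR⟩ := hb.exists_norm_le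
  have hRlim : Tendsto (fun ε : ℝ => ε * (R + R)) (𝓝[>] 0) (𝓝 0) := by
    have : Tendsto (fun ε : ℝ => ε * (R + R)) (𝓝 0) (𝓝 (0 * (R + R))) :=
      tendsto_id.mul_const _
    rw [zero_mul] at this
    exact this.mono_left nhdsWithin_le_nhds
  have hsmall : ∀ᶠ ε : ℝ in 𝓝[>] 0, ε ≤ 1 / 2 :=
    (eventually_le_nhds (by norm_num)).filter_mono nhdsWithin_le_nhds
  filter_upwards [hRlim.eventually_lt_const hr, self_mem_nhdsWithin, hsmall]
    with ε hεr hε0 hε2 z hz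
  have hε0' : (0 : ℝ) < ε := hε0
  have hS : Measurable fun x : EuclideanSpace ℝ (Fin d) => (1 - ε) • x + ε • z := by fun_prop
  have b1 : eLpNorm (fun x => (g - h) ((1 - ε) • x + ε • z)) 2 (volume.restrict U) ≤ 2 ^ d * δ₁ :=
    (eLpNorm_comp_convexCombination_le hU hc (g - h) hε0'.le hε2 hz).trans (by gcongr)
  have b2 : eLpNorm (fun x => h ((1 - ε) • x + ε • z) - h x) 2 (volume.restrict U) ≤ δ / 2 := by
    refine le_trans ?_ hδ₂'
    have := eLpNorm_le_of_ae_bound (p := 2) (μ := volume.restrict U) (C := δ₂)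
      (f := fun x => h ((1 - ε) • x + ε • z) - h x) ?_
    · simpa using this
    · filter_upwards [ae_restrict_mem hU.measurableSet] with x hx
      rw [← dist_eq_norm]
      refine (hr' ?_).le
      rw [dist_eq_norm]
      have : (1 - ε) • x + ε • z - x = ε • (z - x) := by
        rw [sub_smul, smul_sub, one_smul]; abel
      rw [this, norm_smul, Real.norm_of_nonneg hε0'.le]
      refine lt_of_le_of_lt ?_ hεr
      gcongr
      exact (norm_sub_le _ _).trans (add_le_add (hR z hz) (hR x hx))
  have b3 : eLpNorm (h - g) 2 (volume.restrict U) ≤ δ₁ := by rwa [eLpNorm_sub_comm]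
  have hsplit : (fun x => g ((1 - ε) • x + ε • z) - g x) =
      (fun x => (g - h) ((1 - ε) • x + ε • z)) +
        ((fun x => h ((1 - ε) • x + ε • z) - h x) + (h - g)) := by
    ext x; simp
  have hhm : StronglyMeasurable h := hcont.stronglyMeasurable_of_hasCompactSupport hhc
  rw [hsplit]
  calc _ ≤ _ := eLpNorm_add_le
        ((hgm.sub hhm).comp_measurable hS).aestronglyMeasurable
        (((hhm.comp_measurable hS).sub hhm).add (hhm.sub hgm)).aestronglyMeasurable (by norm_num)
    _ ≤ 2 ^ d * δ₁ + (δ / 2 + δ₁) := by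
        refine add_le_add b1 ((eLpNorm_add_le
          ((hhm.comp_measurable hS).sub hhm).aestronglyMeasurable
          (hhm.sub hgm).aestronglyMeasurable (by norm_num)).trans (add_le_add b2 b3))
    _ = (2 ^ d * δ₁ + δ₁) + δ / 2 := by ring
    _ ≤ δ / 2 + δ / 2 := by gcongr
    _ = δ := ENNReal.add_halves δ

theorem IsMollifier.isProbabilityMeasure (hρ : IsMollifier U ρ) :
    IsProbabilityMeasure (volume.withDensity fun x => ENNReal.ofReal (ρ x)) := by
  refine ⟨?_⟩
  rw [withDensity_apply _ MeasurableSet.univ, Measure.restrict_univ,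
    ← ofReal_integral_eq_lintegral_ofReal
      (hρ.contDiff.continuous.integrable_of_hasCompactSupport hρ.hasCompactSupport)
      (Eventually.of_forall hρ.nonneg), hρ.integral_eq_one, ENNReal.ofReal_one]

/-- As `ρ` has integral 1, the difference is the `ρ`-average of `g((1 - ε) x + ε z) - g(x)`, and
Jensen's inequality applies. -/
theorem IsMollifier.enorm_mollify_sub_sq_le (hρ : IsMollifier U ρ)
    (hc : Convex ℝ U) [CompleteSpace F] {ε : ℝ} (hε : 0 < ε) (hε1 : ε ≤ 1)
    (hgi : Integrable (U.indicator g)) (hgm : StronglyMeasurable g)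
    {x : EuclideanSpace ℝ (Fin d)} (hx : x ∈ U) :
    ‖mollify U ρ ε g x - g x‖ₑ ^ 2 ≤
      ∫⁻ z in U, ‖g ((1 - ε) • x + ε • z) - g x‖ₑ ^ 2
        ∂(volume.withDensity fun x => ENNReal.ofReal (ρ x)) := by
  have hP := hρ.isProbabilityMeasure
  have hρm : Measurable fun x => ENNReal.ofReal (ρ x) :=
    hρ.contDiff.continuous.measurable.ennreal_ofReal
  have hS : Measurable fun z : EuclideanSpace ℝ (Fin d) => (1 - ε) • x + ε • z := by fun_prop
  have hρi := hρ.contDiff.continuous.integrable_of_hasCompactSupport hρ.hasCompactSupport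
    (μ := volume)
  obtain ⟨C, hC⟩ := hρ.contDiff.continuous.bounded_above_of_compact_support hρ.hasCompactSupport
  have hi : Integrable (fun z => ρ z • U.indicator g ((1 - ε) • x + ε • z)) := by
    refine Integrable.bdd_smul ?_ C hρ.contDiff.continuous.aestronglyMeasurable
      (Eventually.of_forall hC)
    exact (hgi.comp_add_left ((1 - ε) • x)).comp_smul hε.ne'
  have e1 : mollify U ρ ε g x - g x =
      ∫ z, ρ z • (U.indicator g ((1 - ε) • x + ε • z) - g x) := by
    simp only [smul_sub]
    rw [integral_sub hi (hρi.smul_const _), integral_smul_const, hρ.integral_eq_one, one_smul,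
      mollify]
  have hzU : ∀ z, z ∉ U → ρ z = 0 := fun z hz =>
    image_eq_zero_of_notMem_tsupport fun h => hz (hρ.tsupport_subset h)
  have hm : Measurable fun z => ‖g ((1 - ε) • x + ε • z) - g x‖ₑ :=
    ((hgm.comp_measurable hS).sub stronglyMeasurable_const).enorm
  have e2 : ‖mollify U ρ ε g x - g x‖ₑ ≤
      ∫⁻ z, ‖g ((1 - ε) • x + ε • z) - g x‖ₑ
        ∂(volume.withDensity fun x => ENNReal.ofReal (ρ x)) := by
    rw [e1, lintegral_withDensity_eq_lintegral_mul _ hρm hm]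
    refine (enorm_integral_le_lintegral_enorm _).trans (lintegral_mono fun z => ?_)
    by_cases hz : z ∈ U
    · have : (1 - ε) • x + ε • z ∈ U := hc hx hz (by linarith) hε.le (by ring)
      simp [enorm_smul, this, Real.enorm_of_nonneg (hρ.nonneg z)]
    · simp [hzU z hz]
  -- The measure with density `ρ` is carried by `U`, so restricting it to `U` loses nothing.
  have hPU : (volume.withDensity fun x => ENNReal.ofReal (ρ x)).restrict U =
      volume.withDensity fun x => ENNReal.ofReal (ρ x) := by
    rw [Measure.restrict_eq_self_of_ae_mem]
    rw [ae_withDensity_iff hρm]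
    refine Eventually.of_forall fun z hz => ?_
    by_contra h
    exact hz (by simp [hzU z h])
  rw [hPU]
  exact (pow_le_pow_left₀ zero_le e2 2).trans (sq_lintegral_le hm.aemeasurable)

/-- After exchanging the integrals in `x` and `z`, the error is an average over `z` of errors of
single contractions, and these are small uniformly in `z`. -/
theorem IsMollifier.tendsto_mollify (hρ : IsMollifier U ρ) (hU : IsOpen U) (hc : Convex ℝ U)
    (hb : Bornology.IsBounded U) [CompleteSpace F] [SecondCountableTopology F]
    (hg : MemLp g 2 (volume.restrict U)) :
    Tendsto (fun ε => eLpNorm (fun x => mollify U ρ ε g x - g x) 2 (volume.restrict U))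
      (𝓝[>] 0) (𝓝 0) := by
  have : IsFiniteMeasure (volume.restrict U) := ⟨by simpa using hb.measure_lt_top⟩
  -- A strongly measurable representative provides the joint measurability needed for Tonelli; the
  -- averages do not change.
  wlog hgm : StronglyMeasurable g generalizing g
  · have hae := hg.1.ae_eq_mk
    have := this (hg.ae_eq hae) hg.1.stronglyMeasurable_mk
    refine this.congr' ?_
    filter_upwards [self_mem_nhdsWithin] with ε hε
    rw [← mollify_congr_ae hU hε hae]
    refine eLpNorm_congr_ae ?_
    filter_upwards [hae] with x hx
    rw [hx]
  have hP := hρ.isProbabilityMeasure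
  have hgi : Integrable (U.indicator g) :=
    (integrable_indicator_iff hU.measurableSet).2 (hg.integrable (by norm_num))
  rw [ENNReal.tendsto_nhds_zero]
  intro δ hδ
  have hsmall : ∀ᶠ ε : ℝ in 𝓝[>] 0, ε ≤ 1 :=
    (eventually_le_nhds (by norm_num)).filter_mono nhdsWithin_le_nhds
  filter_upwards [eventually_eLpNorm_comp_convexCombination_sub_le hU hc hb hg hgm hδ.ne',
    self_mem_nhdsWithin, hsmall] with ε hε hε0 hε1
  set P := volume.withDensity fun x => ENNReal.ofReal (ρ x) with hPdef
  refine eLpNorm_two_le_of_lintegral_le ?_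
  have hS : Measurable fun p : EuclideanSpace ℝ (Fin d) × EuclideanSpace ℝ (Fin d) =>
      (1 - ε) • p.1 + ε • p.2 := by fun_prop
  calc ∫⁻ x in U, ‖mollify U ρ ε g x - g x‖ₑ ^ 2
      ≤ ∫⁻ x in U, ∫⁻ z in U, ‖g ((1 - ε) • x + ε • z) - g x‖ₑ ^ 2 ∂P :=
        setLIntegral_mono' hU.measurableSet fun x hx =>
          hρ.enorm_mollify_sub_sq_le hc hε0 hε1 hgi hgm hx
    _ = ∫⁻ z in U, (∫⁻ x in U, ‖g ((1 - ε) • x + ε • z) - g x‖ₑ ^ 2) ∂P := by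
        refine lintegral_lintegral_swap ?_
        exact (((hgm.comp_measurable hS).sub
          (hgm.comp_measurable measurable_fst)).enorm.pow_const 2).aemeasurable
    _ ≤ ∫⁻ z in U, δ ^ 2 ∂P := by
        refine setLIntegral_mono' hU.measurableSet fun z hz => ?_
        rw [← eLpNorm_two_sq]
        gcongr
        exact hε z hz
    _ ≤ δ ^ 2 := by
        rw [setLIntegral_const]
        exact mul_le_of_le_one_right zero_le prob_le_one

end Convergence

/-- On `U` the difference equals `(1 - ε)(mollify G - G) - ε G`, where `mollify G` is the average of
`G`. -/
theorem IsMollifier.eLpNorm_gradient_mollify_sub_le {d : ℕ} {U : Set (EuclideanSpace ℝ (Fin d))}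
    {ρ f : EuclideanSpace ℝ (Fin d) → ℝ}
    {G : EuclideanSpace ℝ (Fin d) → EuclideanSpace ℝ (Fin d)} (hρ : IsMollifier U ρ)
    (hU : IsOpen U) (hc : Convex ℝ U) {ε : ℝ} (hε : 0 < ε) (hε1 : ε ≤ 1)
    (hfi : Integrable (U.indicator f)) (hfG : HasWeakGradient U f G)
    (hG : MemLp G 2 (volume.restrict U)) :
    eLpNorm (fun x => gradient (mollify U ρ ε f) x - G x) 2 (volume.restrict U) ≤
      eLpNorm (fun x => mollify U ρ ε G x - G x) 2 (volume.restrict U) +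
        ‖ε‖ₑ * eLpNorm G 2 (volume.restrict U) := by
  have hgc : Continuous (gradient (mollify U ρ ε f)) := (LinearIsometryEquiv.continuous _).comp
    ((hρ.contDiff_mollify hε hfi).continuous_fderiv (by simp))
  have e1 : (fun x => gradient (mollify U ρ ε f) x - G x) =
      (fun x => gradient (mollify U ρ ε f) x - (1 - ε) • G x) + (-ε) • G := by
    ext1 x
    simp only [Pi.add_apply, Pi.smul_apply]
    module
  have e2 : (fun x => gradient (mollify U ρ ε f) x - (1 - ε) • G x) =ᵐ[volume.restrict U]
      (1 - ε) • (fun x => mollify U ρ ε G x - G x) := by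
    filter_upwards [ae_restrict_mem hU.measurableSet] with x hx
    rw [hρ.gradient_mollify hU hc hε hε1 hfi hfG hx, Pi.smul_apply, smul_sub]
  have e3 : eLpNorm (fun x => gradient (mollify U ρ ε f) x - (1 - ε) • G x) 2
      (volume.restrict U) ≤ eLpNorm (fun x => mollify U ρ ε G x - G x) 2 (volume.restrict U) := by
    rw [eLpNorm_congr_ae e2, eLpNorm_const_smul]
    refine mul_le_of_le_one_left zero_le ?_
    rw [Real.enorm_of_nonneg (by linarith)]
    exact ENNReal.ofReal_le_one.2 (by linarith)
  have m1 : AEStronglyMeasurable (fun x => gradient (mollify U ρ ε f) x - (1 - ε) • G x)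
      (volume.restrict U) := hgc.aestronglyMeasurable.sub (hG.1.const_smul (1 - ε))
  calc _ = eLpNorm ((fun x => gradient (mollify U ρ ε f) x - (1 - ε) • G x) + (-ε) • G) 2
        (volume.restrict U) := by rw [e1]
    _ ≤ _ := eLpNorm_add_le m1 (hG.1.const_smul (-ε)) one_le_two
    _ ≤ _ := add_le_add e3 (by rw [eLpNorm_const_smul, enorm_neg])

/-- Functions smooth on the whole space are dense in `H¹` of a bounded convex open set. -/
theorem MemH1.exists_smooth_approx {d : ℕ} {U : Set (EuclideanSpace ℝ (Fin d))} (hU : IsOpen U)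
    (hc : Convex ℝ U) (hb : Bornology.IsBounded U) (hne : U.Nonempty)
    {f : EuclideanSpace ℝ (Fin d) → ℝ} (hf : MemH1 U f) :
    ∃ u : ℕ → EuclideanSpace ℝ (Fin d) → ℝ, (∀ n, ContDiff ℝ ∞ (u n)) ∧
      Tendsto (fun n => eLpNorm (fun x => u n x - f x) 2 (volume.restrict U)) atTop (𝓝 0) ∧
      Tendsto (fun n => eLpNorm (fun x => gradient (u n) x - weakGrad U f x) 2
        (volume.restrict U)) atTop (𝓝 0) := by
  obtain ⟨ρ, hρ⟩ := exists_isMollifier hU hne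
  have hfin : IsFiniteMeasure (volume.restrict U) := ⟨by simpa using hb.measure_lt_top⟩
  have hfi : Integrable (U.indicator f) :=
    (integrable_indicator_iff hU.measurableSet).2 (hf.1.integrable (by norm_num))
  have hG := hf.memLp_weakGrad hU
  have hlim : Tendsto (fun n : ℕ => (1 : ℝ) / ((n : ℝ) + 1)) atTop (𝓝[>] 0) :=
    tendsto_nhdsWithin_iff.2 ⟨tendsto_one_div_add_atTop_nhds_zero_nat,
      Eventually.of_forall fun n => Set.mem_Ioi.2 (by positivity)⟩
  refine ⟨fun n => mollify U ρ (1 / ((n : ℝ) + 1)) f,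
    fun n => hρ.contDiff_mollify (by positivity) hfi,
    (hρ.tendsto_mollify hU hc hb hf.1).comp hlim, ?_⟩
  have h1 := (hρ.tendsto_mollify hU hc hb hG).comp hlim
  have h2 : Tendsto (fun n : ℕ => ‖(1 : ℝ) / ((n : ℝ) + 1)‖ₑ *
      eLpNorm (weakGrad U f) 2 (volume.restrict U)) atTop (𝓝 0) := by
    have := ENNReal.Tendsto.mul_const (b := eLpNorm (weakGrad U f) 2 (volume.restrict U))
      ((continuous_enorm.tendsto (0 : ℝ)).comp tendsto_one_div_add_atTop_nhds_zero_nat)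
      (Or.inr hG.2.ne)
    simpa using this
  have h3 := h1.add h2
  rw [add_zero] at h3
  refine tendsto_of_tendsto_of_tendsto_of_le_of_le tendsto_const_nhds h3 (fun _ => zero_le)
    fun n => ?_
  refine hρ.eLpNorm_gradient_mollify_sub_le hU hc (by positivity) ?_ hfi hf.hasWeakGradient hG
  rw [div_le_one (by positivity)]
  linarith [n.cast_nonneg (α := ℝ)]


/-! ### Geometry of the simplex -/

section Simplex

variable {d : ℕ} (T : AffineBasis (Fin (d + 1)) ℝ (EuclideanSpace ℝ (Fin d)))

theorem isOpen_openSimplex : IsOpen (openSimplex T) := isOpen_interior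

theorem convex_openSimplex : Convex ℝ (openSimplex T) := (convex_convexHull ℝ _).interior

theorem isCompact_convexHull_range : IsCompact (convexHull ℝ (Set.range T)) :=
  (Set.finite_range T).isCompact_convexHull ℝ

theorem isBounded_openSimplex : Bornology.IsBounded (openSimplex T) :=
  (isCompact_convexHull_range T).isBounded.subset interior_subset

theorem nonempty_openSimplex : (openSimplex T).Nonempty :=
  ⟨_, T.centroid_mem_interior_convexHull⟩

theorem volume_restrict_openSimplex :
    volume.restrict (openSimplex T) = volume.restrict (convexHull ℝ (Set.range T)) :=
  Measure.restrict_congr_set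
    (interior_ae_eq_of_null_frontier ((convex_convexHull ℝ _).addHaar_frontier volume))

theorem face_eq (i : Fin (d + 1)) :
    face T i = {x | T.coord i x = 0 ∧ ∀ j, 0 ≤ T.coord j x} := by
  apply Set.Subset.antisymm
  · intro x hx
    refine ⟨?_, ?_⟩
    · have hc : Convex ℝ {x | T.coord i x = 0} := by
        intro x hx y hy a b _ _ hab
        have := Convex.combo_affine_apply (f := T.coord i) (x := x) (y := y) hab
        simp only [Set.mem_ofPred_eq] at hx hy ⊢
        rw [this, hx, hy]
        simp
      refine convexHull_min ?_ hc hx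
      rintro _ ⟨j, hj, rfl⟩
      exact T.coord_apply_ne (Ne.symm hj)
    · have h : x ∈ convexHull ℝ (Set.range T) :=
        convexHull_mono (Set.image_subset_range _ _) hx
      rw [AffineBasis.convexHull_eq_nonneg_coord] at h
      exact h
  · rintro x ⟨h0, hx⟩
    have h1 : ∑ j ∈ Finset.univ.erase i, T.coord j x = 1 := by
      rw [← T.sum_coord_apply_eq_one x, ← Finset.add_sum_erase _ _ (Finset.mem_univ i), h0,
        zero_add]
    have h2 : ∑ j ∈ Finset.univ.erase i, T.coord j x • T j = x := by
      conv_rhs => rw [← T.linear_combination_coord_eq_self x,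
        ← Finset.add_sum_erase _ _ (Finset.mem_univ i), h0, zero_smul, zero_add]
    rw [← h2]
    refine (convex_convexHull ℝ _).sum_mem (fun j _ => hx j) h1 fun j hj => ?_
    exact subset_convexHull ℝ _ ⟨j, by simpa using hj, rfl⟩

theorem isCompact_face (i : Fin (d + 1)) : IsCompact (face T i) :=
  ((Set.toFinite _).image _).isCompact_convexHull ℝ

theorem coord_linear_sub (i j : Fin (d + 1)) (hj : j ≠ i) :
    (T.coord i).linear (T j - T i) = -1 := by
  have := (T.coord i).linearMap_vsub (T j) (T i)
  rw [vsub_eq_sub] at this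
  rw [this, T.coord_apply_ne hj.symm, T.coord_apply_eq]
  simp

theorem coord_add (i : Fin (d + 1)) (x v : EuclideanSpace ℝ (Fin d)) :
    T.coord i (x + v) = T.coord i x + (T.coord i).linear v := by
  have := (T.coord i).map_vadd x v
  rwa [vadd_eq_add, vadd_eq_add, add_comm v, add_comm _ (T.coord i x)] at this

/-- A point of the cone over a face lies in the simplex iff its height is at most one. -/
theorem cone_mem_convexHull_iff (i : Fin (d + 1)) {t : ℝ} (ht : 0 < t)
    {y : EuclideanSpace ℝ (Fin d)} (hy : T.coord i y = 0) :
    T i + t • (y - T i) ∈ convexHull ℝ (Set.range T) ↔ t ≤ 1 ∧ y ∈ face T i := by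
  have hc : ∀ k, T.coord k (T i + t • (y - T i)) = (1 - t) * T.coord k (T i) + t * T.coord k y := by
    intro k
    have h := (T.coord k).linearMap_vsub y (T i)
    rw [vsub_eq_sub] at h
    rw [coord_add, map_smul, h, vsub_eq_sub, smul_eq_mul]
    ring
  rw [AffineBasis.convexHull_eq_nonneg_coord, face_eq]
  simp only [Set.mem_ofPred_eq, hc]
  constructor
  · intro h
    refine ⟨?_, hy, fun k => ?_⟩
    · have := h i
      rw [hy, T.coord_apply_eq] at this
      linarith
    · by_cases hk : k = i
      · rw [hk, hy]
      · have := h k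
        rw [T.coord_apply_ne hk, mul_zero, zero_add] at this
        exact nonneg_of_mul_nonneg_right this ht
  · rintro ⟨h1, -, h2⟩ k
    have : 0 ≤ T.coord k (T i) := by
      by_cases hk : k = i
      · rw [hk, T.coord_apply_eq]; norm_num
      · rw [T.coord_apply_ne hk]
    have h3 := h2 k
    have h4 : 0 ≤ 1 - t := by linarith
    positivity

end Simplex


/-! ### Integration over the simplex as a cone over a face -/

section Cone

variable {d : ℕ}

/-- The integrand is the derivative of `t ^ d * u (p + t • (y - p))`, which vanishes at `t = 0`
because `d ≠ 0`. -/
theorem integral_cone_radial (hd : d ≠ 0) {u : EuclideanSpace ℝ (Fin d) → ℝ}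
    (hu : ContDiff ℝ 1 u) (p y : EuclideanSpace ℝ (Fin d)) :
    ∫ t in Set.Ioc (0 : ℝ) 1, t ^ (d - 1) *
      ((d : ℝ) * u (p + t • (y - p)) +
        fderiv ℝ u (p + t • (y - p)) (p + t • (y - p) - p)) = u y := by
  rw [← intervalIntegral.integral_of_le zero_le_one]
  have hγ : ∀ t : ℝ, HasDerivAt (fun t : ℝ => p + t • (y - p)) (y - p) t := by
    intro t
    simpa using ((hasDerivAt_id t).smul_const (y - p)).const_add p
  have hud := hu.differentiable (by simp)
  have hD : ∀ t ∈ Set.uIcc (0 : ℝ) 1, HasDerivAt (fun t : ℝ => t ^ d * u (p + t • (y - p)))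
      (t ^ (d - 1) * ((d : ℝ) * u (p + t • (y - p)) +
        fderiv ℝ u (p + t • (y - p)) (p + t • (y - p) - p))) t := by
    intro t _
    have h1 := (hasDerivAt_pow d t).mul
      ((hud (p + t • (y - p))).hasFDerivAt.comp_hasDerivAt t (hγ t))
    convert! h1 using 1
    rw [add_sub_cancel_left, map_smul, smul_eq_mul, Function.comp_apply]
    obtain ⟨n, rfl⟩ := Nat.exists_eq_succ_of_ne_zero hd
    simp only [Nat.succ_eq_add_one, add_tsub_cancel_right, pow_succ]
    ring
  rw [intervalIntegral.integral_eq_sub_of_hasDerivAt hD]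
  · simp [hd]
  · apply Continuous.intervalIntegrable
    have c1 : Continuous fun t : ℝ => p + t • (y - p) := by fun_prop
    exact (continuous_pow _).mul ((continuous_const.mul (hu.continuous.comp c1)).add
      (((hu.continuous_fderiv (by simp)).comp c1).clm_apply (c1.sub continuous_const)))

variable (T : AffineBasis (Fin (d + 1)) ℝ (EuclideanSpace ℝ (Fin d)))

theorem coord_le_one (i : Fin (d + 1)) {x : EuclideanSpace ℝ (Fin d)}
    (hx : x ∈ convexHull ℝ (Set.range T)) : T.coord i x ≤ 1 := by
  rw [AffineBasis.convexHull_eq_nonneg_coord] at hx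
  rw [← T.sum_coord_apply_eq_one x]
  exact Finset.single_le_sum (f := fun k => T.coord k x) (fun k _ => hx k) (Finset.mem_univ i)

/-- The hyperplane of directions parallel to the `i`-th face. -/
noncomputable def faceDirection (i : Fin (d + 1)) : Submodule ℝ (EuclideanSpace ℝ (Fin d)) :=
  LinearMap.ker (T.coord i).linear

theorem finrank_faceDirection (hd : d ≠ 0) (i : Fin (d + 1)) :
    Module.finrank ℝ (faceDirection T i) = d - 1 := by
  have : Nontrivial (Fin (d + 1)) := Fin.nontrivial_iff_two_le.2 (by omega)
  obtain ⟨j, hj⟩ := exists_ne i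
  have h : (T.coord i).linear ≠ 0 := by
    intro h0
    have := coord_linear_sub T i j hj
    rw [h0] at this
    simp at this
  have := Module.Dual.finrank_ker_add_one_of_ne_zero h
  rw [finrank_euclideanSpace_fin] at this
  unfold faceDirection
  omega

theorem isAddHaarMeasure_faceDirection (hd : d ≠ 0) (i : Fin (d + 1)) :
    (Measure.euclideanHausdorffMeasure (d - 1) :
      Measure (faceDirection T i)).IsAddHaarMeasure := by
  rw [← finrank_faceDirection T hd i]
  infer_instance

/-- Coordinates relative to a face and an edge leaving it. -/
noncomputable def coneEquiv (i j : Fin (d + 1)) (hj : j ≠ i) :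
    (faceDirection T i × ℝ) ≃L[ℝ] EuclideanSpace ℝ (Fin d) :=
  (LinearEquiv.ofBijective
    ((faceDirection T i).subtype.coprod (LinearMap.toSpanSingleton ℝ _ (T j - T i)))
    (by
      constructor
      · rw [← LinearMap.ker_eq_bot, LinearMap.ker_eq_bot']
        rintro ⟨⟨z, hz⟩, t⟩ h
        have h' : z + t • (T j - T i) = 0 := by simpa using h
        have h2 := congrArg (T.coord i).linear h'
        rw [map_add, map_smul, coord_linear_sub T i j hj, LinearMap.mem_ker.1 hz, map_zero] at h2
        have ht : t = 0 := by simpa using h2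
        subst ht
        simpa using h'
      · intro x
        refine ⟨⟨⟨x + (T.coord i).linear x • (T j - T i), ?_⟩, -(T.coord i).linear x⟩, ?_⟩
        · rw [faceDirection, LinearMap.mem_ker, map_add, map_smul, coord_linear_sub T i j hj]
          simp
        · change x + (T.coord i).linear x • (T j - T i) +
            (-(T.coord i).linear x) • (T j - T i) = x
          module)).toContinuousLinearEquiv

theorem coneEquiv_apply (i j : Fin (d + 1)) (hj : j ≠ i) (w : faceDirection T i × ℝ) :
    coneEquiv T i j hj w = (w.1 : EuclideanSpace ℝ (Fin d)) + w.2 • (T j - T i) :=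
  rfl

/-- Translation by `T j` is an isometry, so it preserves Hausdorff measure. It moves the integral to
a linear hyperplane, where that measure is a Haar measure and scales under dilations. -/
theorem integral_faceMeasure (i j : Fin (d + 1)) (hj : j ≠ i)
    (u : EuclideanSpace ℝ (Fin d) → ℝ) :
    ∫ y, u y ∂(faceMeasure T i) =
      ∫ z in {z : faceDirection T i | T j + (z : EuclideanSpace ℝ (Fin d)) ∈ face T i},
        u (T j + (z : EuclideanSpace ℝ (Fin d)))
          ∂(Measure.euclideanHausdorffMeasure (d - 1)) := by
  set ι : faceDirection T i → EuclideanSpace ℝ (Fin d) := fun z => T j + z with hι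
  have hiso : Isometry ι := (isometry_add_left (T j)).comp isometry_subtype_coe
  have hemb : MeasurableEmbedding ι := hiso.isClosedEmbedding.measurableEmbedding
  have hsub : face T i ⊆ Set.range ι := by
    intro y hy
    refine ⟨⟨y - T j, ?_⟩, by simp [hι]⟩
    rw [face_eq] at hy
    have := coord_add T i (T j) (y - T j)
    rw [add_sub_cancel, hy.1, T.coord_apply_ne hj.symm, zero_add] at this
    exact this.symm
  have h1 : faceMeasure T i = (Measure.map ι (Measure.euclideanHausdorffMeasure (d - 1))).restrict
      (face T i) := by
    rw [hiso.map_euclideanHausdorffMeasure, Measure.restrict_restrict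
      (isCompact_face T i).measurableSet, Set.inter_eq_left.2 hsub, faceMeasure]
  rw [h1, hemb.setIntegral_map]
  rfl

/-- The divergence theorem for `u(x)(x - pᵢ)`: this field is tangent to the faces through `pᵢ`, and
`x - pᵢ` has constant normal component on `Fᵢ`. The proof views the simplex as a cone over `Fᵢ`,
slices it parallel to `Fᵢ` and integrates along rays from `pᵢ`. -/
theorem exists_cone_formula (hd : d ≠ 0) (i : Fin (d + 1)) :
    ∃ κ : ℝ, ∀ u : EuclideanSpace ℝ (Fin d) → ℝ, ContDiff ℝ 1 u →
      ∫ x in openSimplex T, ((d : ℝ) * u x + fderiv ℝ u x (x - T i)) =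
        κ * ∫ y, u y ∂(faceMeasure T i) := by
  have : Nontrivial (Fin (d + 1)) := Fin.nontrivial_iff_two_le.2 (by omega)
  obtain ⟨j, hj⟩ := exists_ne i
  have hν := isAddHaarMeasure_faceDirection T hd i
  set ν : Measure (faceDirection T i) := Measure.euclideanHausdorffMeasure (d - 1) with hνdef
  set Ψ := coneEquiv T i j hj with hΨ
  have hmap : (Measure.map Ψ (ν.prod volume)).IsAddHaarMeasure := Ψ.isAddHaarMeasure_map _
  -- Uniqueness of Haar measure replaces the computation of a Jacobian. The factor `κ` stays
  -- unspecified; the case `u = 1` fixes it later.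
  have hvol : (volume : Measure (EuclideanSpace ℝ (Fin d))) = _ :=
    Measure.isAddLeftInvariant_eq_smul volume (Measure.map Ψ (ν.prod volume))
  set κ := Measure.addHaarScalarFactor volume (Measure.map Ψ (ν.prod volume)) with hκ
  refine ⟨κ, fun u hu => ?_⟩
  set g : EuclideanSpace ℝ (Fin d) → ℝ := fun x => (d : ℝ) * u x + fderiv ℝ u x (x - T i) with hg
  have hgc : Continuous g := (continuous_const.mul hu.continuous).add
    ((hu.continuous_fderiv (by simp)).clm_apply (continuous_id.sub continuous_const))
  set S := convexHull ℝ (Set.range T) with hS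
  have hSc : IsCompact S := isCompact_convexHull_range T
  set K : Set (faceDirection T i) :=
    {z | T j + (z : EuclideanSpace ℝ (Fin d)) ∈ face T i} with hK
  have hKc : IsCompact K := by
    have hiso : Isometry (fun z : faceDirection T i => T j + (z : EuclideanSpace ℝ (Fin d))) :=
      (isometry_add_left (T j)).comp isometry_subtype_coe
    exact hiso.isClosedEmbedding.isCompact_preimage (isCompact_face T i)
  rw [integral_faceMeasure T i j hj, volume_restrict_openSimplex,
    ← integral_indicator hSc.measurableSet]
  set G : EuclideanSpace ℝ (Fin d) → ℝ := S.indicator g with hG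
  have hGi : Integrable G :=
    (integrable_indicator_iff hSc.measurableSet).2 (hgc.continuousOn.integrableOn_compact hSc)
  have hΨe : MeasurableEmbedding Ψ := Ψ.toHomeomorph.measurableEmbedding
  have hGi' : Integrable (fun w => G (T i + Ψ w)) (ν.prod volume) := by
    have h1 : Integrable (fun x => G (T i + x)) (κ • Measure.map Ψ (ν.prod volume)) := by
      rw [← hvol]; exact hGi.comp_add_left (T i)
    have hκ0 : κ ≠ 0 := (Measure.addHaarScalarFactor_pos_of_isAddHaarMeasure _ _).ne'
    change Integrable _ ((κ : ℝ≥0∞) • Measure.map Ψ (ν.prod volume)) at h1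
    rw [integrable_smul_measure (by simpa using hκ0) (by simp), hΨe.integrable_map_iff] at h1
    exact h1
  have step1 : ∫ x, G x = κ * ∫ w, G (T i + Ψ w) ∂(ν.prod volume) := by
    rw [← integral_add_left_eq_self G (T i), hvol, integral_smul_nnreal_measure,
      hΨe.integral_map]
    rfl
  have hz : ∀ (t : ℝ) (z : faceDirection T i), 0 < t →
      T i + Ψ (t • z, t) = T i + t • (T j + (z : EuclideanSpace ℝ (Fin d)) - T i) := by
    intro t z _
    rw [hΨ, coneEquiv_apply]
    simp only [Submodule.coe_smul]
    module
  -- On the slice at parameter `t` the `i`-th barycentric coordinate is `1 - t`. It exceeds 1 for `t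
  -- < 0`, so the slice misses the simplex; for `0 < t ≤ 1` the slice is the face scaled by `t`,
  -- whence the factor `t ^ (d - 1)`.
  have hslice : ∀ t : ℝ, t ≠ 0 → ∫ z, G (T i + Ψ (z, t)) ∂ν =
      (Set.Ioc (0 : ℝ) 1).indicator (fun t => ∫ z in K, t ^ (d - 1) *
        g (T i + t • (T j + (z : EuclideanSpace ℝ (Fin d)) - T i)) ∂ν) t := by
    intro t ht
    rcases lt_or_gt_of_ne ht with ht | ht
    · rw [Set.indicator_of_notMem (by simp [ht.le])]
      refine integral_eq_zero_of_ae (Eventually.of_forall fun z => ?_)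
      refine Set.indicator_of_notMem (fun hmem => ?_) _
      have h1 := coord_le_one T i hmem
      rw [hΨ, coneEquiv_apply, coord_add, map_add, map_smul, coord_linear_sub T i j hj,
        LinearMap.mem_ker.1 z.2, T.coord_apply_eq] at h1
      simp only [smul_eq_mul] at h1
      linarith
    · have h1 := Measure.integral_comp_smul ν (fun z => G (T i + Ψ (z, t))) t
      rw [finrank_faceDirection T hd i, abs_of_nonneg (by positivity), smul_eq_mul,
        eq_inv_mul_iff_mul_eq₀ (by positivity)] at h1
      rw [← h1]
      simp only [hz t _ ht]
      have hmem : ∀ z : faceDirection T i,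
          T i + t • (T j + (z : EuclideanSpace ℝ (Fin d)) - T i) ∈ S ↔ t ≤ 1 ∧ z ∈ K := by
        intro z
        refine cone_mem_convexHull_iff T i ht ?_
        rw [coord_add, T.coord_apply_ne hj.symm, LinearMap.mem_ker.1 z.2, add_zero]
      by_cases ht1 : t ≤ 1
      · rw [Set.indicator_of_mem (Set.mem_Ioc.2 ⟨ht, ht1⟩), integral_const_mul,
          ← integral_indicator hKc.measurableSet]
        congr 1
        refine integral_congr_ae (Eventually.of_forall fun z => ?_)
        by_cases hzK : z ∈ K
        · simp [hG, Set.indicator, hmem z, ht1, hzK]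
        · simp [hG, Set.indicator, hmem z, hzK]
      · rw [Set.indicator_of_notMem (by simp [ht1])]
        simp [hG, hmem, ht1]
  have step2 : ∫ w, G (T i + Ψ w) ∂(ν.prod volume) =
      ∫ t in Set.Ioc (0 : ℝ) 1, ∫ z in K, t ^ (d - 1) *
        g (T i + t • (T j + (z : EuclideanSpace ℝ (Fin d)) - T i)) ∂ν := by
    rw [integral_prod_symm _ hGi', ← integral_indicator measurableSet_Ioc]
    refine integral_congr_ae ?_
    have h0 : ∀ᵐ t : ℝ, t ≠ 0 := by simp [ae_iff]
    filter_upwards [h0] with t ht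
    exact hslice t ht
  rw [step1, step2, integral_integral_swap]
  · congr 1
    refine integral_congr_ae (Eventually.of_forall fun z => ?_)
    exact integral_cone_radial hd hu (T i) (T j + z)
  · rw [Measure.prod_restrict]
    refine IntegrableOn.mono_set (t := Set.Icc 0 1 ×ˢ K) ?_
      (Set.prod_mono Set.Ioc_subset_Icc_self subset_rfl)
    refine ContinuousOn.integrableOn_compact (isCompact_Icc.prod hKc) ?_
    have c1 : Continuous fun w : ℝ × faceDirection T i =>
        T i + w.1 • (T j + (w.2 : EuclideanSpace ℝ (Fin d)) - T i) := by fun_prop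
    exact ((continuous_fst.pow (d - 1)).mul (hgc.comp c1)).continuousOn

end Cone


/-! ### `L²` preliminaries -/

section LTwo

variable {α F : Type*} [MeasurableSpace α] [NormedAddCommGroup F] {μ : Measure α}

theorem eLpNorm_two_sq_eq_ofReal {f : α → F} (hf : MemLp f 2 μ) :
    eLpNorm f 2 μ ^ 2 = ENNReal.ofReal (∫ x, ‖f x‖ ^ 2 ∂μ) := by
  rw [eLpNorm_two_sq, ofReal_integral_eq_lintegral_ofReal hf.norm.integrable_sq
    (Eventually.of_forall fun x => by positivity)]
  refine lintegral_congr fun x => ?_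
  rw [ENNReal.ofReal_pow (norm_nonneg _), ofReal_norm]

theorem tendsto_integral_of_tendsto_eLpNorm_two [IsFiniteMeasure μ] {u : ℕ → α → ℝ} {g : α → ℝ}
    (hu : ∀ n, MemLp (u n) 2 μ) (hg : MemLp g 2 μ)
    (h : Tendsto (fun n => eLpNorm (fun x => u n x - g x) 2 μ) atTop (𝓝 0)) :
    Tendsto (fun n => ∫ x, u n x ∂μ) atTop (𝓝 (∫ x, g x ∂μ)) := by
  refine tendsto_integral_of_L1' g hg.1
    (Eventually.of_forall fun n => (hu n).integrable (by norm_num)) ?_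
  have h2 : Tendsto (fun n => eLpNorm (fun x => u n x - g x) 2 μ *
      μ Set.univ ^ (1 / (1 : ℝ≥0∞).toReal - 1 / (2 : ℝ≥0∞).toReal)) atTop (𝓝 0) := by
    have := ENNReal.Tendsto.mul_const
      (b := μ Set.univ ^ (1 / (1 : ℝ≥0∞).toReal - 1 / (2 : ℝ≥0∞).toReal)) h
      (Or.inr (ENNReal.rpow_ne_top_of_nonneg (by norm_num) (measure_ne_top μ _)))
    rwa [zero_mul] at this
  refine tendsto_of_tendsto_of_tendsto_of_le_of_le tendsto_const_nhds h2 (fun _ => zero_le)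
    fun n => ?_
  exact eLpNorm_le_eLpNorm_mul_rpow_measure_univ one_le_two ((hu n).sub hg).1

end LTwo

section Bounded

variable {d : ℕ} {F : Type*} [NormedAddCommGroup F] {U : Set (EuclideanSpace ℝ (Fin d))}

theorem memLp_restrict_of_continuous (hU : MeasurableSet U) (hb : Bornology.IsBounded U)
    {f : EuclideanSpace ℝ (Fin d) → F} (hf : Continuous f) (p : ℝ≥0∞)
    (μ : Measure (EuclideanSpace ℝ (Fin d))) [IsFiniteMeasure (μ.restrict U)] :
    MemLp f p (μ.restrict U) := by
  obtain ⟨C, hC⟩ := hb.isCompact_closure.exists_bound_of_continuousOn hf.continuousOn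
  refine MemLp.of_bound hf.aestronglyMeasurable C ?_
  filter_upwards [ae_restrict_mem hU] with x hx
  exact hC x (subset_closure hx)

theorem isFiniteMeasure_restrict_of_isBounded (hb : Bornology.IsBounded U) :
    IsFiniteMeasure (volume.restrict U) := ⟨by simpa using hb.measure_lt_top⟩

theorem continuous_gradient {u : EuclideanSpace ℝ (Fin d) → ℝ} (hu : ContDiff ℝ 1 u) :
    Continuous (gradient u) :=
  (LinearIsometryEquiv.continuous _).comp (hu.continuous_fderiv (by simp))

theorem inner_gradient {u : EuclideanSpace ℝ (Fin d) → ℝ} (x v : EuclideanSpace ℝ (Fin d)) :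
    inner ℝ (gradient u x) v = fderiv ℝ u x v := by
  rw [gradient, InnerProductSpace.toDual_symm_apply]

end Bounded

/-! ### Traces -/

section Trace

variable {d : ℕ} (T : AffineBasis (Fin (d + 1)) ℝ (EuclideanSpace ℝ (Fin d)))

theorem volume_openSimplex_pos : 0 < (volume : Measure _).real (openSimplex T) :=
  ENNReal.toReal_pos ((isOpen_openSimplex T).measure_pos volume (nonempty_openSimplex T)).ne'
    (isBounded_openSimplex T).measure_lt_top.ne

/-- All three claims come from the cone formula for `u = 1`. -/
theorem face_real_pos_and_cone_const_eq (hd : d ≠ 0) (i : Fin (d + 1)) {κ : ℝ}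
    (hκ : ∀ u : EuclideanSpace ℝ (Fin d) → ℝ, ContDiff ℝ 1 u →
      ∫ x in openSimplex T, ((d : ℝ) * u x + fderiv ℝ u x (x - T i)) =
        κ * ∫ y, u y ∂(faceMeasure T i)) :
    0 < (faceMeasure T i).real Set.univ ∧ 0 < κ ∧
      κ * (faceMeasure T i).real Set.univ = d * (volume : Measure _).real (openSimplex T) := by
  have h := hκ (fun _ => 1) contDiff_const
  simp only [mul_one, fderiv_fun_const, Pi.zero_apply, zero_apply, add_zero,
    integral_const, smul_eq_mul, measureReal_restrict_apply_univ] at h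
  have hV := volume_openSimplex_pos T
  have hd' : (0 : ℝ) < d := by positivity
  have hp : 0 < κ * (faceMeasure T i).real Set.univ := by
    rw [← h]; positivity
  have h0 : 0 ≤ (faceMeasure T i).real Set.univ := measureReal_nonneg
  have h1 : 0 < (faceMeasure T i).real Set.univ := by
    rcases h0.eq_or_lt with h1 | h1
    · rw [← h1] at hp; simp at hp
    · exact h1
  exact ⟨h1, (pos_iff_pos_of_mul_pos hp).2 h1, by rw [← h]; ring⟩

theorem isFiniteMeasure_faceMeasure (hd : d ≠ 0) (i : Fin (d + 1)) :
    IsFiniteMeasure (faceMeasure T i) := by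
  obtain ⟨κ, hκ⟩ := exists_cone_formula T hd i
  have := (face_real_pos_and_cone_const_eq T hd i hκ).1
  -- An infinite measure would have real value 0, contradicting positivity.
  refine ⟨lt_top_iff_ne_top.2 fun h => ?_⟩
  rw [Measure.real, h] at this
  simp at this

theorem memLp_faceMeasure (hd : d ≠ 0) (i : Fin (d + 1)) {u : EuclideanSpace ℝ (Fin d) → ℝ}
    (hu : Continuous u) : MemLp u 2 (faceMeasure T i) := by
  have := isFiniteMeasure_faceMeasure T hd i
  unfold faceMeasure at this ⊢
  exact memLp_restrict_of_continuous (isCompact_face T i).measurableSet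
    (isCompact_face T i).isBounded hu 2 _

theorem memLp_openSimplex {F : Type*} [NormedAddCommGroup F] {u : EuclideanSpace ℝ (Fin d) → F}
    (hu : Continuous u) : MemLp u 2 (volume.restrict (openSimplex T)) := by
  have := isFiniteMeasure_restrict_of_isBounded (isBounded_openSimplex T)
  exact memLp_restrict_of_continuous (isOpen_openSimplex T).measurableSet
    (isBounded_openSimplex T) hu 2 _

theorem exists_norm_sub_vertex_le (i : Fin (d + 1)) :
    ∃ R : ℝ, ∀ x ∈ openSimplex T, ‖x - T i‖ ≤ R := by
  obtain ⟨R, hR⟩ := (isBounded_openSimplex T).exists_norm_le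
  exact ⟨R + ‖T i‖, fun x hx => (norm_sub_le _ _).trans (by gcongr; exact hR x hx)⟩

theorem memLp_inner_sub_vertex (i : Fin (d + 1))
    {H : EuclideanSpace ℝ (Fin d) → EuclideanSpace ℝ (Fin d)}
    (hH : MemLp H 2 (volume.restrict (openSimplex T))) :
    MemLp (fun x => inner ℝ (H x) (x - T i)) 2 (volume.restrict (openSimplex T)) := by
  obtain ⟨R, hR⟩ := exists_norm_sub_vertex_le T i
  refine MemLp.of_le_mul (c := R) hH
    (hH.1.inner (continuous_id.sub continuous_const).aestronglyMeasurable) ?_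
  filter_upwards [ae_restrict_mem (isOpen_openSimplex T).measurableSet] with x hx
  rw [mul_comm]
  exact (norm_inner_le_norm _ _).trans (by gcongr; exact hR x hx)

/-- The mean over a face expressed as an integral over the simplex. -/
theorem average_faceMeasure_eq (hd : d ≠ 0) (i : Fin (d + 1))
    {u : EuclideanSpace ℝ (Fin d) → ℝ} (hu : ContDiff ℝ 1 u) :
    (volume : Measure _).real (openSimplex T) * ⨍ y, u y ∂(faceMeasure T i) =
      ∫ x in openSimplex T, (u x + (d : ℝ)⁻¹ * inner ℝ (gradient u x) (x - T i)) := by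
  obtain ⟨κ, hκ⟩ := exists_cone_formula T hd i
  obtain ⟨h1, h2, h3⟩ := face_real_pos_and_cone_const_eq T hd i hκ
  have hd' : (d : ℝ) ≠ 0 := by exact_mod_cast hd
  have h := hκ u hu
  have e : ∀ x, u x + (d : ℝ)⁻¹ * inner ℝ (gradient u x) (x - T i) =
      (d : ℝ)⁻¹ * ((d : ℝ) * u x + fderiv ℝ u x (x - T i)) := by
    intro x
    rw [inner_gradient]
    field_simp
  simp_rw [e]
  rw [integral_const_mul, h, average_eq, smul_eq_mul]
  field_simp
  linear_combination -(∫ x, u x ∂faceMeasure T i) * h3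

/-- The cone formula is applied to `u²`, and the term `2 u ∇u·(x - pᵢ)` is at most `u² + R² |∇u|²`.
-/
theorem exists_trace_inequality (hd : d ≠ 0) (i : Fin (d + 1)) :
    ∃ C : ℝ≥0∞, C ≠ ⊤ ∧ ∀ u : EuclideanSpace ℝ (Fin d) → ℝ, ContDiff ℝ 1 u →
      eLpNorm u 2 (faceMeasure T i) ≤ C * (eLpNorm u 2 (volume.restrict (openSimplex T)) +
        eLpNorm (gradient u) 2 (volume.restrict (openSimplex T))) := by
  obtain ⟨κ, hκ⟩ := exists_cone_formula T hd i
  obtain ⟨-, hκ0, -⟩ := face_real_pos_and_cone_const_eq T hd i hκ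
  obtain ⟨R, hR⟩ := exists_norm_sub_vertex_le T i
  set C₀ : ℝ := κ⁻¹ * (d + 1 + R ^ 2) with hC₀
  have hC₀p : 0 ≤ C₀ := by positivity
  -- The squared norms are compared with constant `C₀`, and `C₀ ≤ (C₀ + 1) ^ 2` avoids a square
  -- root.
  refine ⟨ENNReal.ofReal (C₀ + 1), ENNReal.ofReal_ne_top, fun u hu => ?_⟩
  have hu2 := memLp_openSimplex T hu.continuous
  have hg2 := memLp_openSimplex T (continuous_gradient hu)
  have i1 := hu2.norm.integrable_sq
  have i2 := hg2.norm.integrable_sq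
  have key : ∫ y, ‖u y‖ ^ 2 ∂(faceMeasure T i) ≤
      C₀ * ((∫ x in openSimplex T, ‖u x‖ ^ 2) + ∫ x in openSimplex T, ‖gradient u x‖ ^ 2) := by
    have h := hκ (fun x => u x ^ 2) (hu.pow 2)
    have e : ∫ y, ‖u y‖ ^ 2 ∂(faceMeasure T i) =
        κ⁻¹ * ∫ x in openSimplex T,
          ((d : ℝ) * u x ^ 2 + fderiv ℝ (fun x => u x ^ 2) x (x - T i)) := by
      rw [h, inv_mul_cancel_left₀ hκ0.ne']
      simp
    rw [e, hC₀, mul_assoc]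
    refine mul_le_mul_of_nonneg_left ?_ (inv_nonneg.2 hκ0.le)
    rw [← integral_add i1 i2, ← integral_const_mul]
    have hc : Continuous fun x =>
        (d : ℝ) * u x ^ 2 + fderiv ℝ (fun x => u x ^ 2) x (x - T i) :=
      (continuous_const.mul (hu.continuous.pow 2)).add
        (((hu.pow 2).continuous_fderiv (by simp)).clm_apply (continuous_id.sub continuous_const))
    have := isFiniteMeasure_restrict_of_isBounded (isBounded_openSimplex T)
    refine setIntegral_mono_on ((memLp_openSimplex T hc).integrable (by norm_num))
      ((i1.add i2).const_mul _) (isOpen_openSimplex T).measurableSet fun x hx => ?_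
    have hfd : fderiv ℝ (fun x => u x ^ 2) x (x - T i) =
        2 * u x * inner ℝ (gradient u x) (x - T i) := by
      rw [inner_gradient, fderiv_fun_pow _ (hu.differentiable (by simp) x)]
      simp
    rw [hfd]
    have hin := abs_real_inner_le_norm (gradient u x) (x - T i)
    have hin2 : (inner ℝ (gradient u x) (x - T i)) ^ 2 ≤ ‖gradient u x‖ ^ 2 * R ^ 2 := by
      rw [← sq_abs, ← mul_pow]
      refine pow_le_pow_left₀ (abs_nonneg _) (hin.trans ?_) 2
      gcongr
      exact hR x hx
    have hsq := two_mul_le_add_sq (u x) (inner ℝ (gradient u x) (x - T i))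
    rw [Real.norm_eq_abs, sq_abs]
    have q1 : 0 ≤ (d : ℝ) * ‖gradient u x‖ ^ 2 := by positivity
    have q2 : 0 ≤ R ^ 2 * u x ^ 2 := by positivity
    have q3 : 0 ≤ ‖gradient u x‖ ^ 2 := by positivity
    nlinarith
  refine (ENNReal.pow_le_pow_left_iff (n := 2) (by simp)).1 ?_
  rw [mul_pow, eLpNorm_two_sq_eq_ofReal (memLp_faceMeasure T hd i hu.continuous)]
  calc _ ≤ _ := ENNReal.ofReal_le_ofReal key
    _ = ENNReal.ofReal C₀ * (eLpNorm u 2 (volume.restrict (openSimplex T)) ^ 2 +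
        eLpNorm (gradient u) 2 (volume.restrict (openSimplex T)) ^ 2) := by
      rw [ENNReal.ofReal_mul hC₀p, ENNReal.ofReal_add (by positivity) (by positivity),
        eLpNorm_two_sq_eq_ofReal hu2, eLpNorm_two_sq_eq_ofReal hg2]
    _ ≤ _ := by
      gcongr
      · rw [← ENNReal.ofReal_pow (by positivity)]
        apply ENNReal.ofReal_le_ofReal
        nlinarith
      · rw [add_sq]
        gcongr
        exact le_self_add

/-- By the trace inequality for differences, the restrictions to the face of a smooth approximating
sequence are Cauchy in `L²` of the face. -/
theorem exists_isTrace (hd : d ≠ 0) (i : Fin (d + 1)) {f : EuclideanSpace ℝ (Fin d) → ℝ}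
    (hf : MemH1 (openSimplex T) f) : ∃ g, IsTrace T i f g := by
  obtain ⟨u, hu, hu1, hu2⟩ := hf.exists_smooth_approx (isOpen_openSimplex T)
    (convex_openSimplex T) (isBounded_openSimplex T) (nonempty_openSimplex T)
  obtain ⟨C, hC, hCu⟩ := exists_trace_inequality T hd i
  have hum : ∀ n, MemLp (u n) 2 (faceMeasure T i) :=
    fun n => memLp_faceMeasure T hd i (hu n).continuous
  have hG := hf.memLp_weakGrad (isOpen_openSimplex T)
  have hu' : ∀ n, ContDiff ℝ 1 (u n) := fun n => (hu n).of_le (by simp)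
  set μ := volume.restrict (openSimplex T)
  have hcauchy : CauchySeq fun n => (hum n).toLp (u n) := by
    rw [Lp.cauchySeq_Lp_iff_cauchySeq_eLpNorm]
    set a := fun n => eLpNorm (fun x => u n x - f x) 2 μ with ha
    set b := fun n => eLpNorm (fun x => gradient (u n) x - weakGrad (openSimplex T) f x) 2 μ
      with hb
    have hlim : Tendsto (fun n : ℕ × ℕ => C * ((a n.1 + a n.2) + (b n.1 + b n.2)))
        atTop (𝓝 0) := by
      have h1 : Tendsto (fun n : ℕ × ℕ => n.1) atTop atTop := by
        rw [← prod_atTop_atTop_eq]; exact tendsto_fst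
      have h2 : Tendsto (fun n : ℕ × ℕ => n.2) atTop atTop := by
        rw [← prod_atTop_atTop_eq]; exact tendsto_snd
      have := ENNReal.Tendsto.const_mul (a := C) (((hu1.comp h1).add (hu1.comp h2)).add
        ((hu2.comp h1).add (hu2.comp h2))) (Or.inr hC)
      simpa using this
    refine tendsto_of_tendsto_of_tendsto_of_le_of_le tendsto_const_nhds hlim (fun _ => zero_le)
      fun n => ?_
    have e1 : eLpNorm (⇑((hum n.1).toLp (u n.1)) - ⇑((hum n.2).toLp (u n.2))) 2
        (faceMeasure T i) = eLpNorm (u n.1 - u n.2) 2 (faceMeasure T i) :=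
      eLpNorm_congr_ae ((hum n.1).coeFn_toLp.sub (hum n.2).coeFn_toLp)
    have e2 : gradient (u n.1 - u n.2) = gradient (u n.1) - gradient (u n.2) := by
      ext1 x
      simp only [gradient, Pi.sub_apply]
      rw [fderiv_sub ((hu' _).differentiable (by simp) x) ((hu' _).differentiable (by simp) x),
        map_sub]
    have e3 : u n.1 - u n.2 = (fun x => u n.1 x - f x) - (fun x => u n.2 x - f x) := by
      ext x; simp
    have e4 : gradient (u n.1) - gradient (u n.2) =
        (fun x => gradient (u n.1) x - weakGrad (openSimplex T) f x) -
        (fun x => gradient (u n.2) x - weakGrad (openSimplex T) f x) := by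
      ext1 x; simp
    have m1 : ∀ n, AEStronglyMeasurable (fun x => u n x - f x) μ :=
      fun n => (hu n).continuous.aestronglyMeasurable.sub hf.1.1
    have m2 : ∀ n, AEStronglyMeasurable
        (fun x => gradient (u n) x - weakGrad (openSimplex T) f x) μ :=
      fun n => (continuous_gradient (hu' n)).aestronglyMeasurable.sub hG.1
    change eLpNorm (⇑((hum n.1).toLp (u n.1)) - ⇑((hum n.2).toLp (u n.2))) 2
        (faceMeasure T i) ≤ _
    rw [e1]
    refine (hCu _ ((hu' n.1).sub (hu' n.2))).trans ?_
    gcongr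
    · change eLpNorm (u n.1 - u n.2) 2 μ ≤ _
      rw [e3]
      exact eLpNorm_sub_le (m1 _) (m1 _) one_le_two
    · change eLpNorm (gradient (u n.1 - u n.2)) 2 μ ≤ _
      rw [e2, e4]
      exact eLpNorm_sub_le (m2 _) (m2 _) one_le_two
  obtain ⟨g, hg⟩ := cauchySeq_tendsto_of_complete hcauchy
  refine ⟨g, Lp.memLp g, u, hu, hu1, hu2, ?_⟩
  rw [Lp.tendsto_Lp_iff_tendsto_eLpNorm'] at hg
  refine hg.congr fun n => eLpNorm_congr_ae ?_
  filter_upwards [(hum n).coeFn_toLp] with x hx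
  simp [hx]

/-- The identity for smooth functions passes to the limit. The right side does not involve `g`, so
the choice made in `trace` cannot affect the interpolant. -/
theorem IsTrace.average_eq (hd : d ≠ 0) {i : Fin (d + 1)} {f g : EuclideanSpace ℝ (Fin d) → ℝ}
    (hf : MemH1 (openSimplex T) f) (hg : IsTrace T i f g) :
    (volume : Measure _).real (openSimplex T) * ⨍ y, g y ∂(faceMeasure T i) =
      ∫ x in openSimplex T,
        (f x + (d : ℝ)⁻¹ * inner ℝ (weakGrad (openSimplex T) f x) (x - T i)) := by
  obtain ⟨hgm, u, hu, hu1, hu2, hu3⟩ := hg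
  have hfin := isFiniteMeasure_faceMeasure T hd i
  have hfin' := isFiniteMeasure_restrict_of_isBounded (isBounded_openSimplex T)
  have hu' : ∀ n, ContDiff ℝ 1 (u n) := fun n => (hu n).of_le (by simp)
  have hG := hf.memLp_weakGrad (isOpen_openSimplex T)
  obtain ⟨R, hR⟩ := exists_norm_sub_vertex_le T i
  have hmeas := (isOpen_openSimplex T).measurableSet
  have hinner := fun H hH => memLp_inner_sub_vertex T i (H := H) hH
  set μ := volume.restrict (openSimplex T) with hμ
  have l1 : Tendsto (fun n => ∫ y, u n y ∂(faceMeasure T i)) atTop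
      (𝓝 (∫ y, g y ∂(faceMeasure T i))) :=
    tendsto_integral_of_tendsto_eLpNorm_two
      (fun n => memLp_faceMeasure T hd i (hu n).continuous) hgm hu3
  have l2 : Tendsto (fun n => ∫ x, u n x ∂μ) atTop (𝓝 (∫ x, f x ∂μ)) :=
    tendsto_integral_of_tendsto_eLpNorm_two
      (fun n => memLp_openSimplex T (hu n).continuous) hf.1 hu1
  have hgn : ∀ n, MemLp (gradient (u n)) 2 μ :=
    fun n => memLp_openSimplex T (continuous_gradient (hu' n))
  have l3 : Tendsto (fun n => ∫ x, inner ℝ (gradient (u n) x) (x - T i) ∂μ) atTop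
      (𝓝 (∫ x, inner ℝ (weakGrad (openSimplex T) f x) (x - T i) ∂μ)) := by
    refine tendsto_integral_of_tendsto_eLpNorm_two (fun n => hinner _ (hgn n)) (hinner _ hG) ?_
    have h0 := ENNReal.Tendsto.const_mul (a := ENNReal.ofReal R) hu2
      (Or.inr ENNReal.ofReal_ne_top)
    rw [mul_zero] at h0
    refine tendsto_of_tendsto_of_tendsto_of_le_of_le tendsto_const_nhds h0 (fun _ => zero_le)
      fun n => ?_
    refine eLpNorm_le_mul_eLpNorm_of_ae_le_mul ?_ 2
    filter_upwards [ae_restrict_mem hmeas] with x hx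
    rw [← inner_sub_left, mul_comm]
    exact (norm_inner_le_norm _ _).trans (by gcongr; exact hR x hx)
  have hL : Tendsto (fun n => (volume : Measure _).real (openSimplex T) *
      ⨍ y, u n y ∂(faceMeasure T i)) atTop (𝓝 ((volume : Measure _).real (openSimplex T) *
        ⨍ y, g y ∂(faceMeasure T i))) := by
    simp only [MeasureTheory.average_eq]
    exact (l1.const_smul _).const_mul _
  refine tendsto_nhds_unique hL ?_
  have e : ∀ (v : EuclideanSpace ℝ (Fin d) → ℝ)
      (H : EuclideanSpace ℝ (Fin d) → EuclideanSpace ℝ (Fin d)), MemLp v 2 μ → MemLp H 2 μ →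
      ∫ x, (v x + (d : ℝ)⁻¹ * inner ℝ (H x) (x - T i)) ∂μ =
        (∫ x, v x ∂μ) + (d : ℝ)⁻¹ * ∫ x, inner ℝ (H x) (x - T i) ∂μ := by
    intro v H hv hH
    rw [integral_add (hv.integrable (by norm_num))
      (((hinner H hH).integrable (by norm_num)).const_mul _), integral_const_mul]
  rw [e _ _ hf.1 hG]
  have hR' := l2.add (l3.const_mul (d : ℝ)⁻¹)
  refine hR'.congr fun n => ?_
  rw [average_faceMeasure_eq T hd i (hu' n),
    e _ _ (memLp_openSimplex T (hu n).continuous) (hgn n)]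

end Trace


/-! ### An anisotropic Poincaré inequality on convex sets -/

section Poincare

variable {d : ℕ} {U : Set (EuclideanSpace ℝ (Fin d))}

theorem isProbabilityMeasure_restrict_Ioc :
    IsProbabilityMeasure ((volume : Measure ℝ).restrict (Set.Ioc 0 1)) := ⟨by simp⟩

theorem enorm_sub_sq_le_lintegral {u : EuclideanSpace ℝ (Fin d) → ℝ} (hu : ContDiff ℝ 1 u)
    (x y : EuclideanSpace ℝ (Fin d)) :
    ‖u x - u y‖ₑ ^ 2 ≤
      ∫⁻ t in Set.Ioc (0 : ℝ) 1, ‖fderiv ℝ u ((1 - t) • y + t • x) (x - y)‖ₑ ^ 2 := by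
  have := isProbabilityMeasure_restrict_Ioc
  have c1 : Continuous fun t : ℝ => (1 - t) • y + t • x := by fun_prop
  have c2 : Continuous fun t : ℝ => fderiv ℝ u ((1 - t) • y + t • x) (x - y) :=
    ((hu.continuous_fderiv (by simp)).comp c1).clm_apply continuous_const
  have hD : ∀ t ∈ Set.uIcc (0 : ℝ) 1, HasDerivAt (fun t : ℝ => u ((1 - t) • y + t • x))
      (fderiv ℝ u ((1 - t) • y + t • x) (x - y)) t := by
    intro t _
    refine (hu.differentiable (by simp) _).hasFDerivAt.comp_hasDerivAt t ?_
    have := (((hasDerivAt_id t).const_sub 1).smul_const y).add ((hasDerivAt_id t).smul_const x)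
    convert! this using 1
    simp only [neg_smul, one_smul]
    abel
  have h := intervalIntegral.integral_eq_sub_of_hasDerivAt hD (c2.intervalIntegrable 0 1)
  have e : u x - u y = ∫ t in Set.Ioc (0 : ℝ) 1, fderiv ℝ u ((1 - t) • y + t • x) (x - y) := by
    rw [← intervalIntegral.integral_of_le zero_le_one, h]
    simp
  rw [e]
  exact (pow_le_pow_left₀ zero_le (enorm_integral_le_lintegral_enorm _) 2).trans
    (sq_lintegral_le c2.enorm.measurable.aemeasurable)

theorem enorm_sub_average_sq_le [IsFiniteMeasure (volume.restrict U)] (hU : volume U ≠ 0)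
    {u : EuclideanSpace ℝ (Fin d) → ℝ} (hu : Continuous u)
    (hui : Integrable u (volume.restrict U)) (x : EuclideanSpace ℝ (Fin d)) :
    ‖u x - ⨍ y in U, u y‖ₑ ^ 2 ≤ (volume U)⁻¹ * ∫⁻ y in U, ‖u x - u y‖ₑ ^ 2 := by
  have hne : NeZero (volume.restrict U) := ⟨by simpa using hU⟩
  have e : u x - ⨍ y in U, u y =
      ∫ y, (u x - u y) ∂((volume.restrict U Set.univ)⁻¹ • volume.restrict U) := by
    rw [integral_sub (integrable_const _) (hui.to_average), ← average_eq', average_const,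
      ← average_eq']
  have h1 := sq_lintegral_le (P := (volume.restrict U Set.univ)⁻¹ • volume.restrict U)
    (f := fun y => ‖u x - u y‖ₑ) (continuous_const.sub hu).enorm.measurable.aemeasurable
  rw [e]
  refine (pow_le_pow_left₀ zero_le (enorm_integral_le_lintegral_enorm _) 2).trans (h1.trans ?_)
  rw [lintegral_smul_measure, Measure.restrict_apply_univ, smul_eq_mul]

/-- Substituting in `x` has Jacobian `t ^ d` and substituting in `y` has `(1 - t) ^ d`. Using
whichever of `t`, `1 - t` is at least `1 / 2` keeps the factor below `2 ^ d` for all `t`. -/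
theorem lintegral_lintegral_segment_le (hU : IsOpen U) (hc : Convex ℝ U)
    {W : EuclideanSpace ℝ (Fin d) → ℝ≥0∞} (hW : Measurable W) {t : ℝ}
    (ht : t ∈ Set.Ioc (0 : ℝ) 1) :
    ∫⁻ x in U, ∫⁻ y in U, W ((1 - t) • y + t • x) ≤ 2 ^ d * (∫⁻ z in U, W z) * volume U := by
  rcases le_total (1 / 2) t with h | h
  · rw [lintegral_lintegral_swap (by fun_prop), ← setLIntegral_const]
    refine setLIntegral_mono' hU.measurableSet fun y hy => ?_
    refine (setLIntegral_comp_convexCombination_le hU hc W ht.1 ht.2 hy).trans ?_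
    gcongr
    exact ofReal_inv_pow_le h
  · rw [← setLIntegral_const]
    refine setLIntegral_mono' hU.measurableSet fun x hx => ?_
    have := setLIntegral_comp_convexCombination_le hU hc W (s := 1 - t) (by linarith)
      (by linarith [ht.1]) hx
    simp only [sub_sub_cancel] at this
    simp only [add_comm ((1 - t) • _)]
    refine this.trans ?_
    gcongr
    exact ofReal_inv_pow_le (by linarith)

/-- The derivative of `u` along `x - y` is at most `M ∑ |∂u/∂eᵢ|` at every point of the segment. The
size and shape of `U` enter only through `M` and the vectors `e i`, and the volume of `U` cancels.
-/
theorem eLpNorm_sub_average_le_of_contDiff (hU : IsOpen U) (hc : Convex ℝ U)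
    (hb : Bornology.IsBounded U) (hne : U.Nonempty) {ι : Type*} [Fintype ι]
    (e : ι → EuclideanSpace ℝ (Fin d)) {M : ℝ} (hM : 0 ≤ M)
    (he : ∀ x ∈ U, ∀ y ∈ U, ∃ c : ι → ℝ, (∀ i, |c i| ≤ M) ∧ x - y = ∑ i, c i • e i)
    {u : EuclideanSpace ℝ (Fin d) → ℝ} (hu : ContDiff ℝ 1 u) :
    eLpNorm (fun x => u x - ⨍ y in U, u y) 2 (volume.restrict U) ≤
      ENNReal.ofReal (2 ^ d * M) *
        ∑ i, eLpNorm (fun x => inner ℝ (gradient u x) (e i)) 2 (volume.restrict U) := by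
  have hfin := isFiniteMeasure_restrict_of_isBounded hb
  have hU0 : volume U ≠ 0 := (hU.measure_pos volume hne).ne'
  have hUt : volume U ≠ ⊤ := hb.measure_lt_top.ne
  have hui : Integrable u (volume.restrict U) :=
    (memLp_restrict_of_continuous hU.measurableSet hb hu.continuous 1 volume).integrable le_rfl
  have hfd : Continuous (fderiv ℝ u) := hu.continuous_fderiv (by simp)
  set w : EuclideanSpace ℝ (Fin d) → ℝ := ∑ i, fun x => ‖fderiv ℝ u x (e i)‖ with hw
  have hwc : Continuous w := by
    rw [hw]
    have : ∀ i, Continuous fun x => fderiv ℝ u x (e i) := fun i => hfd.clm_apply continuous_const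
    simp only [Finset.sum_fn]
    fun_prop
  have hseg : ∀ x ∈ U, ∀ y ∈ U, ∀ z, ‖fderiv ℝ u z (x - y)‖ₑ ^ 2 ≤ ‖M * w z‖ₑ ^ 2 := by
    intro x hx y hy z
    obtain ⟨c, hcM, hxy⟩ := he x hx y hy
    refine pow_le_pow_left₀ zero_le ?_ 2
    rw [enorm_le_iff_norm_le, hxy, map_sum]
    refine (norm_sum_le _ _).trans (le_trans ?_ (le_abs_self _))
    rw [hw, Finset.sum_apply, Finset.mul_sum]
    refine Finset.sum_le_sum fun i _ => ?_
    rw [map_smul, norm_smul, Real.norm_eq_abs]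
    gcongr
    exact hcM i
  have hWm : Measurable fun z => ‖M * w z‖ₑ ^ 2 :=
    (continuous_const.mul hwc).enorm.measurable.pow_const 2
  have key : ∫⁻ x in U, ‖u x - ⨍ y in U, u y‖ₑ ^ 2 ≤ 2 ^ d * ∫⁻ z in U, ‖M * w z‖ₑ ^ 2 := by
    calc ∫⁻ x in U, ‖u x - ⨍ y in U, u y‖ₑ ^ 2
        ≤ ∫⁻ x in U, (volume U)⁻¹ * ∫⁻ y in U, ∫⁻ t in Set.Ioc (0 : ℝ) 1,
            ‖M * w ((1 - t) • y + t • x)‖ₑ ^ 2 := by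
          refine setLIntegral_mono' hU.measurableSet fun x hx => ?_
          refine (enorm_sub_average_sq_le hU0 hu.continuous hui x).trans ?_
          refine mul_le_mul' le_rfl ?_
          refine setLIntegral_mono' hU.measurableSet fun y hy => ?_
          exact (enorm_sub_sq_le_lintegral hu x y).trans
            (lintegral_mono fun t => hseg x hx y hy _)
      _ = (volume U)⁻¹ * ∫⁻ x in U, ∫⁻ y in U, ∫⁻ t in Set.Ioc (0 : ℝ) 1,
            ‖M * w ((1 - t) • y + t • x)‖ₑ ^ 2 := by
          rw [lintegral_const_mul' _ _ (by simpa using hU0)]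
      _ = (volume U)⁻¹ * ∫⁻ t in Set.Ioc (0 : ℝ) 1, ∫⁻ x in U, ∫⁻ y in U,
            ‖M * w ((1 - t) • y + t • x)‖ₑ ^ 2 := by
          congr 1
          -- Tonelli in two stages: `t` is moved past `y` for fixed `x`, and then past `x`.
          have hm : Measurable fun p : (EuclideanSpace ℝ (Fin d) × ℝ) ×
              EuclideanSpace ℝ (Fin d) => ‖M * w ((1 - p.1.2) • p.2 + p.1.2 • p.1.1)‖ₑ ^ 2 := by
            refine hWm.comp ?_
            fun_prop
          have hswap : ∀ x, ∫⁻ y in U, ∫⁻ t in Set.Ioc (0 : ℝ) 1,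
              ‖M * w ((1 - t) • y + t • x)‖ₑ ^ 2 = ∫⁻ t in Set.Ioc (0 : ℝ) 1, ∫⁻ y in U,
              ‖M * w ((1 - t) • y + t • x)‖ₑ ^ 2 := by
            intro x
            refine lintegral_lintegral_swap (hWm.comp ?_).aemeasurable
            fun_prop
          simp_rw [hswap]
          exact lintegral_lintegral_swap hm.lintegral_prod_right'.aemeasurable
      _ ≤ (volume U)⁻¹ * ∫⁻ t in Set.Ioc (0 : ℝ) 1,
            2 ^ d * (∫⁻ z in U, ‖M * w z‖ₑ ^ 2) * volume U := by
          refine mul_le_mul' le_rfl ?_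
          exact setLIntegral_mono' measurableSet_Ioc fun t ht =>
            lintegral_lintegral_segment_le hU hc hWm ht
      _ = 2 ^ d * ∫⁻ z in U, ‖M * w z‖ₑ ^ 2 := by
          rw [setLIntegral_const, Real.volume_Ioc, sub_zero, ENNReal.ofReal_one, mul_one,
            mul_comm, mul_assoc, ENNReal.mul_inv_cancel hU0 hUt, mul_one]
  have h1 : eLpNorm (fun x => u x - ⨍ y in U, u y) 2 (volume.restrict U) ≤
      2 ^ d * eLpNorm (M • w) 2 (volume.restrict U) := by
    refine eLpNorm_two_le_of_lintegral_le (key.trans ?_)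
    rw [mul_pow, eLpNorm_two_sq]
    exact mul_le_mul' (le_self_pow₀ (one_le_pow₀ (by norm_num)) (by norm_num)) le_rfl
  refine h1.trans ?_
  rw [eLpNorm_const_smul, ENNReal.ofReal_mul (by positivity), ENNReal.ofReal_pow (by norm_num),
    ← mul_assoc, Real.enorm_of_nonneg hM]
  simp only [ENNReal.ofReal_ofNat]
  gcongr
  refine (eLpNorm_sum_le (fun i _ =>
    (hfd.clm_apply continuous_const).norm.aestronglyMeasurable) one_le_two).trans ?_
  refine Finset.sum_le_sum fun i _ => ?_
  rw [eLpNorm_norm]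
  simp_rw [inner_gradient]
  exact le_rfl

/-- The Poincaré inequality with derivatives in prescribed directions, for `H¹` functions. -/
theorem MemH1.eLpNorm_sub_average_le (hU : IsOpen U) (hc : Convex ℝ U)
    (hb : Bornology.IsBounded U) (hne : U.Nonempty) {ι : Type*} [Fintype ι]
    (e : ι → EuclideanSpace ℝ (Fin d)) {M : ℝ} (hM : 0 ≤ M)
    (he : ∀ x ∈ U, ∀ y ∈ U, ∃ c : ι → ℝ, (∀ i, |c i| ≤ M) ∧ x - y = ∑ i, c i • e i)
    {g : EuclideanSpace ℝ (Fin d) → ℝ} (hg : MemH1 U g) :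
    eLpNorm (fun x => g x - ⨍ y in U, g y) 2 (volume.restrict U) ≤
      ENNReal.ofReal (2 ^ d * M) *
        ∑ i, eLpNorm (fun x => inner ℝ (weakGrad U g x) (e i)) 2 (volume.restrict U) := by
  obtain ⟨u, hu, hu1, hu2⟩ := hg.exists_smooth_approx hU hc hb hne
  have hfin := isFiniteMeasure_restrict_of_isBounded hb
  have hu' : ∀ n, ContDiff ℝ 1 (u n) := fun n => (hu n).of_le (by simp)
  have hG := hg.memLp_weakGrad hU
  have hmu : ∀ n, MemLp (u n) 2 (volume.restrict U) := fun n =>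
    memLp_restrict_of_continuous hU.measurableSet hb (hu n).continuous 2 volume
  have havg : Tendsto (fun n => ⨍ y in U, u n y) atTop (𝓝 (⨍ y in U, g y)) := by
    simp only [MeasureTheory.average_eq]
    exact (tendsto_integral_of_tendsto_eLpNorm_two hmu hg.1 hu1).const_smul _
  have hconst : Tendsto (fun n => eLpNorm (fun _ : EuclideanSpace ℝ (Fin d) =>
      (⨍ y in U, u n y) - ⨍ y in U, g y) 2 (volume.restrict U)) atTop (𝓝 0) := by
    have h0 := (havg.sub_const (⨍ y in U, g y)).enorm
    rw [sub_self, enorm_zero] at h0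
    have := ENNReal.Tendsto.mul_const (b := volume.restrict U Set.univ ^ (1 / (2 : ℝ≥0∞).toReal))
      h0 (Or.inr (ENNReal.rpow_ne_top_of_nonneg (by simp) (measure_ne_top _ _)))
    rw [zero_mul] at this
    refine this.congr fun n => ?_
    rw [eLpNorm_const' _ (by simp) (by simp)]
  set A := fun i => eLpNorm (fun x => inner ℝ (weakGrad U g x) (e i)) 2 (volume.restrict U)
  set a := fun n => eLpNorm (fun x => u n x - g x) 2 (volume.restrict U) with ha
  set b := fun n => eLpNorm (fun x => gradient (u n) x - weakGrad U g x) 2 (volume.restrict U)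
    with hbdef
  set k := fun n => eLpNorm (fun _ : EuclideanSpace ℝ (Fin d) =>
    (⨍ y in U, u n y) - ⨍ y in U, g y) 2 (volume.restrict U) with hk
  -- The bound for `g` is the one for `u n` plus three vanishing errors: in the function, in its
  -- mean, and in the directional derivatives, the last being at most `‖e i‖` times the gradient
  -- error.
  have hlim : Tendsto (fun n => a n + (ENNReal.ofReal (2 ^ d * M) *
      ∑ i, (A i + ENNReal.ofReal ‖e i‖ * b n) + k n)) atTop
      (𝓝 (0 + (ENNReal.ofReal (2 ^ d * M) * ∑ i, (A i + ENNReal.ofReal ‖e i‖ * 0) + 0))) := by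
    refine hu1.add (Tendsto.add ?_ hconst)
    refine ENNReal.Tendsto.const_mul ?_ (Or.inr ENNReal.ofReal_ne_top)
    refine tendsto_finsetSum _ fun i _ => tendsto_const_nhds.add ?_
    exact ENNReal.Tendsto.const_mul hu2 (Or.inr ENNReal.ofReal_ne_top)
  simp only [mul_zero, add_zero, zero_add] at hlim
  refine ge_of_tendsto' hlim fun n => ?_
  have hsplit : (fun x => g x - ⨍ y in U, g y) = (fun x => g x - u n x) +
      ((fun x => u n x - ⨍ y in U, u n y) + fun _ => (⨍ y in U, u n y) - ⨍ y in U, g y) := by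
    ext x; simp
  have m1 : AEStronglyMeasurable (fun x => g x - u n x) (volume.restrict U) :=
    hg.1.1.sub (hmu n).1
  have m2 : AEStronglyMeasurable (fun x => u n x - ⨍ y in U, u n y) (volume.restrict U) :=
    (hmu n).1.sub aestronglyMeasurable_const
  have ea : eLpNorm (fun x => g x - u n x) 2 (volume.restrict U) = a n :=
    eLpNorm_sub_comm g (u n) 2 _
  rw [hsplit]
  refine (eLpNorm_add_le m1 (m2.add aestronglyMeasurable_const) one_le_two).trans ?_
  rw [ea]
  gcongr
  refine (eLpNorm_add_le m2 aestronglyMeasurable_const one_le_two).trans ?_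
  gcongr
  refine (eLpNorm_sub_average_le_of_contDiff hU hc hb hne e hM he (hu' n)).trans ?_
  gcongr with i
  have hs2 : (fun x => inner ℝ (gradient (u n) x) (e i)) =
      (fun x => inner ℝ (weakGrad U g x) (e i)) +
        fun x => inner ℝ (gradient (u n) x - weakGrad U g x) (e i) := by
    ext x
    simp [inner_sub_left]
  have m3 : AEStronglyMeasurable (fun x => inner ℝ (weakGrad U g x) (e i))
      (volume.restrict U) := hG.1.inner aestronglyMeasurable_const
  have m4 : AEStronglyMeasurable (fun x => inner ℝ (gradient (u n) x - weakGrad U g x) (e i))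
      (volume.restrict U) :=
    ((continuous_gradient (hu' n)).aestronglyMeasurable.sub hG.1).inner
      aestronglyMeasurable_const
  rw [hs2]
  refine (eLpNorm_add_le m3 m4 one_le_two).trans ?_
  gcongr
  refine eLpNorm_le_mul_eLpNorm_of_ae_le_mul (Eventually.of_forall fun x => ?_) 2
  rw [mul_comm]
  exact norm_inner_le_norm _ _

end Poincare


/-! ### The interpolation error -/

/-- Differences of convex combinations of the vertices are combinations of the distinguished
edges with bounded coefficients. -/
theorem EdgeCondition.exists_coeff {d : ℕ} {p : Fin (d + 1) → EuclideanSpace ℝ (Fin d)}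
    {b : Fin d → Fin (d + 1)} (h : EdgeCondition d p b) {δ : Fin (d + 1) → ℝ}
    (hδ : ∀ i, |δ i| ≤ 1) (hs : ∑ i, δ i = 0) :
    ∃ c : Fin d → ℝ, (∀ i, |c i| ≤ 2) ∧ ∑ i, δ i • p i = ∑ i, c i • (p i.succ - p (b i)) := by
  cases h with
  | triangle p h =>
    refine ⟨![δ 1, δ 2], ?_, ?_⟩
    · intro i
      fin_cases i
      · exact (hδ 1).trans one_le_two
      · exact (hδ 2).trans one_le_two
    · simp only [Fin.sum_univ_succ, Fin.sum_univ_zero] at hs ⊢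
      simp only [Fin.isValue, Fin.succ_zero_eq_one, Fin.succ_one_eq_two, add_zero,
        Matrix.cons_val_zero, Matrix.cons_val_one] at hs ⊢
      have h0 : δ 0 = -(δ 1 + δ 2) := by linarith
      rw [h0]
      module
  | tetrahedronTypeI p h side =>
    refine ⟨![δ 1, δ 2, δ 3], ?_, ?_⟩
    · intro i
      fin_cases i
      · exact (hδ 1).trans one_le_two
      · exact (hδ 2).trans one_le_two
      · exact (hδ 3).trans one_le_two
    · rw [Fin.sum_univ_four] at hs ⊢
      rw [Fin.sum_univ_three]
      change _ = δ 1 • (p 1 - p 0) + δ 2 • (p 2 - p 0) + δ 3 • (p 3 - p 0)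
      have h0 : δ 0 = -(δ 1 + δ 2 + δ 3) := by linarith
      rw [h0]
      module
  | tetrahedronTypeII p h side =>
    -- Here `p₃` is reached from `p₁` through `p₂`, so the first edge carries both `δ 1` and `δ 2`.
    -- This is where the bound 2 comes from.
    refine ⟨![δ 1 + δ 2, δ 2, δ 3], ?_, ?_⟩
    · intro i
      fin_cases i
      · exact (abs_add_le _ _).trans (by linarith [hδ 1, hδ 2])
      · exact (hδ 2).trans one_le_two
      · exact (hδ 3).trans one_le_two
    · rw [Fin.sum_univ_four] at hs ⊢
      rw [Fin.sum_univ_three]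
      change _ = (δ 1 + δ 2) • (p 1 - p 0) + δ 2 • (p 2 - p 1) + δ 3 • (p 3 - p 0)
      have h0 : δ 0 = -(δ 1 + δ 2 + δ 3) := by linarith
      rw [h0]
      module

section Interpolant

variable {d : ℕ} (T : AffineBasis (Fin (d + 1)) ℝ (EuclideanSpace ℝ (Fin d)))

theorem EdgeCondition.exists_coeff_sub {T : AffineBasis (Fin (d + 1)) ℝ (EuclideanSpace ℝ (Fin d))}
    {b : Fin d → Fin (d + 1)} (h : EdgeCondition d T b)
    {x y : EuclideanSpace ℝ (Fin d)} (hx : x ∈ openSimplex T) (hy : y ∈ openSimplex T) :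
    ∃ c : Fin d → ℝ, (∀ i, |c i| ≤ 2) ∧ x - y = ∑ i, c i • (T i.succ - T (b i)) := by
  have hx' : x ∈ convexHull ℝ (Set.range T) := interior_subset hx
  have hy' : y ∈ convexHull ℝ (Set.range T) := interior_subset hy
  have h1 : ∀ i, |T.coord i x - T.coord i y| ≤ 1 := by
    intro i
    have h1 := coord_le_one T i hx'
    have h2 := coord_le_one T i hy'
    rw [AffineBasis.convexHull_eq_nonneg_coord] at hx' hy'
    exact abs_sub_le_iff.2 ⟨by linarith [hy' i], by linarith [hx' i]⟩
  have h2 : ∑ i, (T.coord i x - T.coord i y) = 0 := by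
    simp only [Finset.sum_sub_distrib, T.sum_coord_apply_eq_one, sub_self]
  obtain ⟨c, hc, hcs⟩ := h.exists_coeff h1 h2
  refine ⟨c, hc, ?_⟩
  rw [← hcs]
  simp only [sub_smul, Finset.sum_sub_distrib, T.linear_combination_coord_eq_self]

theorem sum_coord_linear (v : EuclideanSpace ℝ (Fin d)) : ∑ i, (T.coord i).linear v = 0 := by
  have h := T.sum_coord_apply_eq_one (0 + v)
  simp only [coord_add, Finset.sum_add_distrib, T.sum_coord_apply_eq_one] at h
  linarith

theorem sum_coord_linear_smul (v : EuclideanSpace ℝ (Fin d)) :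
    ∑ i, (T.coord i).linear v • T i = v := by
  have h := T.linear_combination_coord_eq_self (0 + v)
  simp_rw [coord_add, add_smul] at h
  rw [Finset.sum_add_distrib, T.linear_combination_coord_eq_self, zero_add, zero_add] at h
  exact h

/-- Splitting off the continuous linear part makes smoothness and the derivative immediate. -/
theorem interpolant_eq (f : EuclideanSpace ℝ (Fin d) → ℝ) (x : EuclideanSpace ℝ (Fin d)) :
    interpolant T f x = interpolant T f 0 +
      (∑ i, (-(d * ⨍ y, trace T i f y ∂(faceMeasure T i))) •
        LinearMap.toContinuousLinearMap (T.coord i).linear) x := by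
  have hx : ∀ i, T.coord i x = T.coord i 0 + (T.coord i).linear x := by
    intro i
    rw [← coord_add, zero_add]
  simp only [interpolant, nodalBasis, hx, sum_apply,
    smul_apply, LinearMap.coe_toContinuousLinearMap', smul_eq_mul,
    ← Finset.sum_add_distrib]
  refine Finset.sum_congr rfl fun i _ => ?_
  ring

theorem contDiff_interpolant (f : EuclideanSpace ℝ (Fin d) → ℝ) :
    ContDiff ℝ 1 (interpolant T f) := by
  rw [funext (interpolant_eq T f)]
  exact contDiff_const.add (ContinuousLinearMap.contDiff _)

theorem isTrace_trace (hd : d ≠ 0) (i : Fin (d + 1)) {f : EuclideanSpace ℝ (Fin d) → ℝ}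
    (hf : MemH1 (openSimplex T) f) : IsTrace T i f (trace T i f) := by
  have h := exists_isTrace T hd i hf
  rw [trace, dif_pos h]
  exact h.choose_spec

/-- The gradient of the interpolant is the mean of the gradient. -/
theorem inner_gradient_interpolant (hd : d ≠ 0) {f : EuclideanSpace ℝ (Fin d) → ℝ}
    (hf : MemH1 (openSimplex T) f) (x v : EuclideanSpace ℝ (Fin d)) :
    inner ℝ (gradient (interpolant T f) x) v =
      ⨍ y in openSimplex T, inner ℝ (weakGrad (openSimplex T) f y) v := by
  have hfin := isFiniteMeasure_restrict_of_isBounded (isBounded_openSimplex T)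
  have hG := hf.memLp_weakGrad (isOpen_openSimplex T)
  have hV := volume_openSimplex_pos T
  have hd' : (d : ℝ) ≠ 0 := by exact_mod_cast hd
  set G := weakGrad (openSimplex T) f
  set V := (volume : Measure (EuclideanSpace ℝ (Fin d))).real (openSimplex T) with hVdef
  set μ := (volume : Measure (EuclideanSpace ℝ (Fin d))).restrict (openSimplex T) with hμ
  have hGi : Integrable G μ := hG.integrable (by norm_num)
  have hGv : ∀ w, Integrable (fun y => inner ℝ (G y) w) μ := fun w => hGi.inner_const w
  -- Only the last integral depends on `i`; the vertex `T 0` is an arbitrary base point. The common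
  -- part drops out below because the linear parts of the barycentric coordinates sum to zero.
  have hm : ∀ i, V * (d * ⨍ y, trace T i f y ∂(faceMeasure T i)) =
      (∫ y, (d * f y + inner ℝ (G y) (y - T 0)) ∂μ) + ∫ y, inner ℝ (G y) (T 0) ∂μ -
        ∫ y, inner ℝ (G y) (T i) ∂μ := by
    intro i
    have i1 : Integrable (fun y => d * f y + inner ℝ (G y) (y - T 0)) μ :=
      ((hf.1.integrable (by norm_num)).const_mul _).add
        ((memLp_inner_sub_vertex T 0 hG).integrable (by norm_num))
    have i2 : Integrable (fun y => d * f y + inner ℝ (G y) (y - T 0) + inner ℝ (G y) (T 0)) μ :=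
      i1.add (hGv _)
    rw [mul_left_comm, (isTrace_trace T hd i hf).average_eq T hd hf, ← integral_add i1 (hGv _),
      ← integral_sub i2 (hGv _), ← integral_const_mul]
    refine integral_congr_ae (Eventually.of_forall fun y => ?_)
    simp only [inner_sub_right]
    field_simp
    ring
  rw [inner_gradient, funext (interpolant_eq T f), fderiv_const_add, ContinuousLinearMap.fderiv,
    average_eq, smul_eq_mul, eq_inv_mul_iff_mul_eq₀ (by simpa [hμ] using hV.ne')]
  have hVμ : μ.real Set.univ = V := by simp [hμ, hVdef]
  rw [hVμ]
  simp only [sum_apply, smul_apply,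
    LinearMap.coe_toContinuousLinearMap', smul_eq_mul, Finset.mul_sum]
  have e : ∀ i, V * (-(d * ⨍ y, trace T i f y ∂(faceMeasure T i)) * (T.coord i).linear v) =
      (T.coord i).linear v * (-((∫ y, (d * f y + inner ℝ (G y) (y - T 0)) ∂μ) +
        ∫ y, inner ℝ (G y) (T 0) ∂μ)) +
      ∫ y, inner ℝ (G y) ((T.coord i).linear v • T i) ∂μ := by
    intro i
    simp only [inner_smul_right]
    rw [integral_const_mul]
    linear_combination -(T.coord i).linear v * hm i
  simp_rw [e]
  rw [Finset.sum_add_distrib, ← Finset.sum_mul, sum_coord_linear, zero_mul, zero_add,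
    ← integral_finsetSum _ fun i _ => hGv _]
  simp_rw [← inner_sum, sum_coord_linear_smul]

theorem memH1_interpolant_sub {f : EuclideanSpace ℝ (Fin d) → ℝ}
    (hf : MemH1 (openSimplex T) f) :
    MemH1 (openSimplex T) (fun x => interpolant T f x - f x) :=
  ⟨(memLp_openSimplex T (contDiff_interpolant T f).continuous).sub hf.1, _,
    (hasWeakGradient_of_contDiff (contDiff_interpolant T f)).sub hf.hasWeakGradient,
    (memLp_openSimplex T (continuous_gradient (contDiff_interpolant T f))).sub
      (hf.memLp_weakGrad (isOpen_openSimplex T))⟩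

theorem eLpNorm_le_sum_eval {α : Type*} [MeasurableSpace α] {μ : Measure α}
    {H : α → EuclideanSpace ℝ (Fin d)} (hH : AEStronglyMeasurable H μ) :
    eLpNorm H 2 μ ≤ ∑ k, eLpNorm (fun x => H x k) 2 μ := by
  have e : H = ∑ k, fun x => H x k • EuclideanSpace.single k (1 : ℝ) := by
    ext x k
    simp [Finset.sum_apply, Pi.single_apply]
  have hk : ∀ k, AEStronglyMeasurable (fun x => H x k) μ := fun k =>
    (EuclideanSpace.proj (𝕜 := ℝ) k).continuous.comp_aestronglyMeasurable hH
  conv_lhs => rw [e]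
  refine (eLpNorm_sum_le (fun k _ => (hk k).smul_const _) one_le_two).trans ?_
  refine Finset.sum_le_sum fun k _ => ?_
  refine eLpNorm_mono fun x => ?_
  simp [norm_smul]

theorem memLp_dirDerivGrad {U : Set (EuclideanSpace ℝ (Fin d))} (hU : IsOpen U)
    {f : EuclideanSpace ℝ (Fin d) → ℝ} (hf : MemH2 U f) (r : EuclideanSpace ℝ (Fin d)) :
    MemLp (dirDerivGrad U r f) 2 (volume.restrict U) :=
  MemLp.of_eval_piLp fun k => ((hf.2 k).memLp_weakGrad hU).const_inner r

theorem edgeLength_smul_edgeDir {p : Fin (d + 1) → EuclideanSpace ℝ (Fin d)}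
    {b : Fin d → Fin (d + 1)} (i : Fin d) :
    edgeLength p b i • edgeDir p b i = p i.succ - p (b i) := by
  rw [edgeLength, edgeDir]
  rcases eq_or_ne (‖p i.succ - p (b i)‖) 0 with h | h
  · rw [h, zero_smul, norm_eq_zero.1 h]
  · rw [smul_inv_smul₀ h]

/-- The interpolation error estimate with extended norms. -/
theorem eLpNorm_gradient_interpolant_sub_le (hd : d ≠ 0)
    {b : Fin d → Fin (d + 1)} (hb : EdgeCondition d T b) {f : EuclideanSpace ℝ (Fin d) → ℝ}
    (hf : MemH2 (openSimplex T) f) :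
    eLpNorm (fun x => gradient (interpolant T f) x - weakGrad (openSimplex T) f x) 2
        (volume.restrict (openSimplex T)) ≤
      ENNReal.ofReal (d * (2 ^ d * 2)) * ∑ i, ENNReal.ofReal (edgeLength T b i) *
        eLpNorm (dirDerivGrad (openSimplex T) (edgeDir T b i) f) 2
          (volume.restrict (openSimplex T)) := by
  have hG := hf.1.memLp_weakGrad (isOpen_openSimplex T)
  set μ := (volume : Measure (EuclideanSpace ℝ (Fin d))).restrict (openSimplex T) with hμ
  refine (eLpNorm_le_sum_eval ((continuous_gradient
    (contDiff_interpolant T f)).aestronglyMeasurable.sub hG.1)).trans ?_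
  have hk : ∀ k : Fin d, eLpNorm (fun x => (gradient (interpolant T f) x -
      weakGrad (openSimplex T) f x) k) 2 μ ≤ ENNReal.ofReal (2 ^ d * 2) *
        ∑ i, ENNReal.ofReal (edgeLength T b i) *
          eLpNorm (dirDerivGrad (openSimplex T) (edgeDir T b i) f) 2 μ := by
    intro k
    -- The mean identity in the `k`-th coordinate direction turns the error component into the
    -- deviation of `∂ₖf` from its mean.
    have h1 : ∀ x, gradient (interpolant T f) x k =
        ⨍ y in openSimplex T, weakGrad (openSimplex T) f y k := by
      intro x
      have := inner_gradient_interpolant T hd hf.1 x (EuclideanSpace.single k 1)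
      simpa only [EuclideanSpace.inner_single_right, RCLike.conj_to_real, one_mul, conj_trivial]
        using this
    have h2 : eLpNorm (fun x => (gradient (interpolant T f) x -
        weakGrad (openSimplex T) f x) k) 2 μ = eLpNorm (fun x => weakGrad (openSimplex T) f x k -
          ⨍ y in openSimplex T, weakGrad (openSimplex T) f y k) 2 μ := by
      simp only [PiLp.sub_apply, h1]
      exact eLpNorm_sub_comm (fun _ => _) _ _ _
    rw [h2]
    refine ((hf.2 k).eLpNorm_sub_average_le (isOpen_openSimplex T) (convex_openSimplex T)
      (isBounded_openSimplex T) (nonempty_openSimplex T) (fun i => T i.succ - T (b i))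
      zero_le_two fun x hx y hy => hb.exists_coeff_sub hx hy).trans ?_
    gcongr with i
    refine eLpNorm_le_mul_eLpNorm_of_ae_le_mul (Eventually.of_forall fun x => ?_) 2
    rw [← edgeLength_smul_edgeDir (p := T) (b := b) i, inner_smul_right, norm_mul,
      Real.norm_of_nonneg (show 0 ≤ edgeLength T b i from norm_nonneg _)]
    refine mul_le_mul_of_nonneg_left ?_ (norm_nonneg _)
    rw [real_inner_comm]
    exact PiLp.norm_apply_le (dirDerivGrad (openSimplex T) (edgeDir T b i) f x) k
  -- The same bound holds for each of the `d` components, which gives the factor `d`.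
  refine (Finset.sum_le_sum fun k _ => hk k).trans ?_
  rw [Finset.sum_const, Finset.card_univ, Fintype.card_fin, nsmul_eq_mul, ← mul_assoc,
    ENNReal.ofReal_mul (p := (d : ℝ)) (by positivity), ENNReal.ofReal_natCast]

/-- The passage to real-valued norms uses that the directional derivatives of the gradient lie in
`L²`, so no infinite norm is read as 0. -/
theorem h1Seminorm_interpolant_sub_le (hd : d ≠ 0)
    {b : Fin d → Fin (d + 1)} (hb : EdgeCondition d T b) {f : EuclideanSpace ℝ (Fin d) → ℝ}
    (hf : MemH2 (openSimplex T) f) :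
    h1Seminorm (openSimplex T) (fun x => interpolant T f x - f x) ≤
      d * (2 ^ d * 2) * ∑ i, edgeLength T b i *
        lpNorm (dirDerivGrad (openSimplex T) (edgeDir T b i) f) 2
          (volume.restrict (openSimplex T)) := by
  have hU := isOpen_openSimplex T
  have hw := ((hasWeakGradient_of_contDiff (contDiff_interpolant T f)).sub
    hf.1.hasWeakGradient).weakGrad_ae_eq hU
  have hD := fun i => memLp_dirDerivGrad hU hf (edgeDir T b i)
  have hm := ((memH1_interpolant_sub T hf.1).memLp_weakGrad hU).1
  have h := eLpNorm_gradient_interpolant_sub_le T hd hb hf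
  have hl : ∀ i, 0 ≤ edgeLength T b i := fun i => norm_nonneg _
  rw [h1Seminorm, ← toReal_eLpNorm hm, eLpNorm_congr_ae hw]
  refine ENNReal.toReal_le_of_le_ofReal
    (mul_nonneg (by positivity) (Finset.sum_nonneg fun i _ => mul_nonneg (hl i) lpNorm_nonneg)) ?_
  refine h.trans_eq ?_
  rw [ENNReal.ofReal_mul (p := d * (2 ^ d * 2)) (by positivity),
    ENNReal.ofReal_sum_of_nonneg fun i _ => mul_nonneg (hl i) lpNorm_nonneg]
  congr 1
  refine Finset.sum_congr rfl fun i _ => ?_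
  rw [ENNReal.ofReal_mul (hl i), ofReal_lpNorm (hD i)]

end Interpolant

end CrouzeixRaviart

theorem mainTheorem8 (d : ℕ) (hd : d = 2 ∨ d = 3) :
    ∃ c : ℝ, 0 < c ∧
      ∀ (T : AffineBasis (Fin (d + 1)) ℝ (EuclideanSpace ℝ (Fin d)))
        (b : Fin d → Fin (d + 1)), CrouzeixRaviart.EdgeCondition d T b →
      ∀ φ : EuclideanSpace ℝ (Fin d) → ℝ,
        CrouzeixRaviart.MemH2 (CrouzeixRaviart.openSimplex T) φ →
        (∀ i, ∃ g, CrouzeixRaviart.IsTrace T i φ g) ∧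
        CrouzeixRaviart.MemH1 (CrouzeixRaviart.openSimplex T)
          (fun x => CrouzeixRaviart.interpolant T φ x - φ x) ∧
        CrouzeixRaviart.h1Seminorm (CrouzeixRaviart.openSimplex T)
            (fun x => CrouzeixRaviart.interpolant T φ x - φ x) ≤
          c * ∑ i : Fin d, CrouzeixRaviart.edgeLength T b i *
            lpNorm (CrouzeixRaviart.dirDerivGrad (CrouzeixRaviart.openSimplex T)
                (CrouzeixRaviart.edgeDir T b i) φ) 2
              (volume.restrict (CrouzeixRaviart.openSimplex T)) := by
  have hd0 : d ≠ 0 := by omega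
  have hdp : (0 : ℝ) < d := by positivity
  -- The factors are `d` for the components, `2 ^ d` for the Jacobian along segments and 2 for the
  -- edge coefficients.
  refine ⟨d * (2 ^ d * 2), by positivity, fun T b hb φ hφ => ⟨fun i => ?_, ?_, ?_⟩⟩
  · exact CrouzeixRaviart.exists_isTrace T hd0 i hφ.1
  · exact CrouzeixRaviart.memH1_interpolant_sub T hφ.1
  · exact CrouzeixRaviart.h1Seminorm_interpolant_sub_le T hd0 hb hφ
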